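/- Let $T$ be a closed operator with compact resolvent in a separable complex Hilbert space $\mathcal H$, with infinitely many eigenvalues $\lambda_n$, $n\in\mathbb N=\{1,2,\dots\}$, repeated according to algebraic multiplicity and ordered so that $|\lambda_{n+1}|\ge|\lambda_n|$. For $\lambda\in\sigma(T)$ let $$Q_\lambda=\frac1{2\pi i}\int_{|z-\lambda|=\delta_\lambda}(z-T)^{-1}\,dz,\qquad \delta_\lambda=\tfrac12\operatorname{dist}(\lambda,\sigma(T)\setminus\{\lambda\}),$$ be the Riesz projection. Let $p\in\mathbb N$ and assume, for some $R>0$, $\epsilon_0\in(0,1]$, $K\ge1$ and $N\in[-1,\infty)$: (i) $\sigma(T)\subset B_R(0)\cup\{z\in\mathbb C:|\arg z|\le(1-\epsilon_0)\frac{\pi}{p}\}$; (ii) $\|(re^{i\frac{\pi}{p}(1+2k)}-T)^{-1}\|\le Kr^N$ for all $r\ge R+1$ and $k=0,1,\dots,p-1$; (iii) there is $R_0>R$ such that the geometric and algebraic multiplicities of every $\lambda\in\sigma(T)$ with $|\lambda|>R_0$ coincide; (iv) the system of spectral projections is complete, i.e. the linear span of $\bigcup_{\lambda\in\sigma(T)}\operatorname{Ran}Q_\lambda$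 is dense in $\mathcal H$; (v) there are $c,\kappa>0$ with $|\lambda_n|\ge cn^\kappa$ for all $n\in\mathbb N$. Let there exist $\epsilon_1\in(0,1]$ and a continuous curve $\Gamma:(0,\infty)\to\{z\in\mathbb C:\operatorname{Re}z\ge1,\ |\arg z|\le(1-\epsilon_1)\frac{\pi}{p}\}$ such that $|\Gamma(t)|\to+\infty$ as $t\to+\infty$ and, for some $\eta,r>0$ and $0<\tau\le p/2$, $$\|(z-T)^{-1}\|\ge\exp(\eta|z|^\tau)\qquad\text{for all } z\in\Gamma((0,\infty))\cap\rho(T)\text{ with }|z|>r.$$ If $\tau=p/2$, assume in addition that $N<-1+\frac1{2p}$. Then $$\limsup_{n\to\infty}\frac{\|Q_{\lambda_n}\|}{\exp(\gamma|\lambda_n|^\tau)}=\infty\qquad\text{for every }\gamma\in(0,\gamma_0),\quad \gamma_0=\eta\cos\Big((1-\epsilon_0)\frac{\tau}{p}\pi\Big).$$ If, in addition, $\lim_{n\to\infty}\arg\lambda_n=\vartheta_0\in(-\frac\pi p,\frac\pi p)$, then the same holds for every $\gamma\in(0,\gamma_0)$ with $\gamma_0=\eta\cos(\tau\vartheta_0)$.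 -/

import Mathlib

/-!
Unbounded operators on a complex Hilbert space are `LinearPMap`s.
We define their resolvent set, resolvent, spectrum, Riesz projections,
multiplicities, and the class of operators considered in the theorem.
-/

section Resolvent

variable {H : Type*} [NormedAddCommGroup H] [InnerProductSpace ℂ H]

/-- `S` is a bounded everywhere defined two-sided inverse of `z - T`. -/
def LinearPMap.IsResolventAt (T : H →ₗ.[ℂ] H) (z : ℂ) (S : H →L[ℂ] H) : Prop :=
  (∀ x : T.domain, S (z • (x : H) - T x) = x) ∧
    ∀ y : H, ∃ h : S y ∈ T.domain, z • S y - T ⟨S y, h⟩ = y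

/-- The resolvent set `ρ(T)`: all `z` such that `z - T` is a bijection from the domain of `T`
onto `H` with bounded inverse. -/
def LinearPMap.resolventSet (T : H →ₗ.[ℂ] H) : Set ℂ :=
  {z | ∃ S : H →L[ℂ] H, T.IsResolventAt z S}

/-- The spectrum `σ(T)`, the complement of the resolvent set. -/
def LinearPMap.spectrum (T : H →ₗ.[ℂ] H) : Set ℂ :=
  (T.resolventSet)ᶜ

open Classical in
/-- The resolvent `(z - T)⁻¹` for `z ∈ ρ(T)` (and `0`, by convention, for `z ∈ σ(T)`). -/
noncomputable def LinearPMap.resolvent (T : H →ₗ.[ℂ] H) (z : ℂ) : H →L[ℂ] H :=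
  if h : z ∈ T.resolventSet then Classical.choose h else 0

theorem LinearPMap.isResolventAt_resolvent {T : H →ₗ.[ℂ] H} {z : ℂ} (h : z ∈ T.resolventSet) :
    T.IsResolventAt z (T.resolvent z) := by
  unfold LinearPMap.resolvent
  rw [dif_pos h]
  exact Classical.choose_spec h

/-- The inverse of `z - T` is unique, so `resolvent` does not depend on a choice. -/
theorem LinearPMap.IsResolventAt.eq_resolvent {T : H →ₗ.[ℂ] H} {z : ℂ} {S : H →L[ℂ] H}
    (h : T.IsResolventAt z S) : S = T.resolvent z := by
  have h' := LinearPMap.isResolventAt_resolvent (T := T) (z := z) ⟨S, h⟩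
  ext y
  obtain ⟨hy, e⟩ := h'.2 y
  exact (congrArg S e.symm).trans (h.1 ⟨T.resolvent z y, hy⟩)

/-- `T` has compact resolvent: `ρ(T)` is non-empty and `(z - T)⁻¹` is compact for some
(equivalently, for every) `z ∈ ρ(T)`. -/
def LinearPMap.HasCompactResolvent (T : H →ₗ.[ℂ] H) : Prop :=
  ∃ z ∈ T.resolventSet, IsCompactOperator (T.resolvent z)

/-- `δ_μ`, half of the distance of `μ` from the rest of the spectrum. -/
noncomputable def LinearPMap.rieszRadius (T : H →ₗ.[ℂ] H) (μ : ℂ) : ℝ :=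
  Metric.infDist μ (T.spectrum \ {μ}) / 2

/-- The Riesz (spectral) projection
`Q_μ = (2πi)⁻¹ ∮_{|z - μ| = δ_μ} (z - T)⁻¹ dz`. -/
noncomputable def LinearPMap.rieszProj (T : H →ₗ.[ℂ] H) (μ : ℂ) : H →L[ℂ] H :=
  (2 * (Real.pi : ℂ) * Complex.I)⁻¹ • ∮ z in C(μ, T.rieszRadius μ), T.resolvent z

/-- The algebraic multiplicity of `μ`: the dimension of the range of the Riesz projection. -/
noncomputable def LinearPMap.algMult (T : H →ₗ.[ℂ] H) (μ : ℂ) : ℕ :=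
  Module.finrank ℂ (LinearMap.range (T.rieszProj μ : H →ₗ[ℂ] H))

/-- The geometric multiplicity of `μ`: the dimension of the kernel of `T - μ`. -/
noncomputable def LinearPMap.geomMult (T : H →ₗ.[ℂ] H) (μ : ℂ) : ℕ :=
  Module.finrank ℂ (LinearMap.ker (T.toFun - μ • T.domain.subtype))

/-- `lam 0, lam 1, lam 2, …` are the eigenvalues of `T`, repeated according to their algebraic
multiplicity and ordered by non-decreasing modulus (for `T` with compact resolvent the spectrum
consists of eigenvalues). In particular there are infinitely many of them. -/
structure LinearPMap.IsEigenvalueSequence (T : H →ₗ.[ℂ] H) (lam : ℕ → ℂ) : Prop where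
  mem_spectrum : ∀ n, lam n ∈ T.spectrum
  encard_eq : ∀ μ ∈ T.spectrum, {n | lam n = μ}.encard = (T.algMult μ : ℕ∞)
  monotone_norm : Monotone fun n => ‖lam n‖

/-- Standing assumptions on the operator `T` with eigenvalues `lam`. The sequence `lam` is indexed
from `0`, so that `lam n` is the eigenvalue number `n + 1`. -/
structure LinearPMap.SectorialAssumption (T : H →ₗ.[ℂ] H) (lam : ℕ → ℂ) (p : ℕ)
    (R ε₀ K N : ℝ) : Prop where
  isClosed : T.IsClosed
  hasCompactResolvent : T.HasCompactResolvent
  isEigenvalueSequence : T.IsEigenvalueSequence lam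
  one_le_p : 1 ≤ p
  R_pos : 0 < R
  ε₀_mem : ε₀ ∈ Set.Ioc (0 : ℝ) 1
  one_le_K : 1 ≤ K
  neg_one_le_N : -1 ≤ N
  /-- The spectrum lies in the union of a disc and a sector. -/
  spectrum_subset : T.spectrum ⊆
    Metric.ball (0 : ℂ) R ∪ {z | |z.arg| ≤ (1 - ε₀) * (Real.pi / p)}
  /-- Polynomial bound on rays. The points on these rays belong to the resolvent set by
  `spectrum_subset`. -/
  resolvent_le : ∀ r : ℝ, R + 1 ≤ r → ∀ k : ℕ, k < p →
    ‖T.resolvent ((r : ℂ) * Complex.exp (Complex.I * ((Real.pi / p * (1 + 2 * k) : ℝ) : ℂ)))‖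
      ≤ K * r ^ N
  /-- Eigenvalues of large modulus are semisimple. -/
  semisimple : ∃ R₀ : ℝ, R < R₀ ∧ ∀ μ ∈ T.spectrum, R₀ < ‖μ‖ → T.geomMult μ = T.algMult μ
  /-- The ranges of the spectral projections span a dense subspace. -/
  complete : Dense
    ((⨆ μ ∈ T.spectrum, LinearMap.range (T.rieszProj μ : H →ₗ[ℂ] H) : Submodule ℂ H) : Set H)
  eigenvalue_growth : ∃ c κ : ℝ, 0 < c ∧ 0 < κ ∧ ∀ n : ℕ, c * ((n : ℝ) + 1) ^ κ ≤ ‖lam n‖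

end Resolvent

/-! ### Resolvent identities and eigenspaces of an unbounded operator. -/

section ResolventTheory

variable {H : Type*} [NormedAddCommGroup H] [InnerProductSpace ℂ H]

namespace LinearPMap

variable {T : H →ₗ.[ℂ] H} {z w μ ν : ℂ}

/-! The argument is by contradiction: moderate growth of the Riesz projections forces moderate
growth of the resolvent. Suppose the limsup is finite, so `‖Q_λ‖ ≤ C exp(γ|λ|^τ)` for the large
eigenvalues. Let `q` be an eventual lower bound of `cos (τ arg λ)` with `γ < ηq`, and choose `t`
between `γ/q` and `η`. The damping factor `G = exp(-t z^τ)` is bounded by one on the sector `|arg z|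
≤ π/p`, because `τ ≤ p/2`. At the eigenvalues it overcompensates the projections: `∑ |G(λ)| ‖Q_λ‖`
is finite by the power growth of `|λ_n|`.

For `y` in the dense span of the ranges of the projections, `(z - T)⁻¹ y` is outside a large disc a
finite sum of simple poles `(z - μ)⁻¹ Q_μ y` plus a bounded holomorphic term
(`exists_resolvent_eq_add_sum`). Subtracting `∑ G(μ) (z - μ)⁻¹ Q_μ y` from `G(z) (z - T)⁻¹ y`
removes all the poles. On the rays and on an inner arc the difference is polynomially bounded, since
`|(z - μ)⁻¹| ≤ ‖(z - T)⁻¹‖`. The maximum principle carries the bound into the sector, uniformly in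
`y` with `‖y‖ ≤ 1`; by density `G (z - T)⁻¹` is bounded by a polynomial plus the subtracted sum
(`norm_mul_norm_resolvent_le`).

The subtracted sum is bounded on circles avoiding exponentially small neighbourhoods of all `|λ_n|`.
Such circles have arbitrarily large radius `ρ`, and the curve meets them. There `|G| ‖(z - T)⁻¹‖ ≥
exp((η - t)ρ^τ)`, which exceeds every polynomial.

The sector is treated as a strip in the coordinate `w = log z`; this makes `z^τ` entire in `w` and
covers `p = 1`, where the two boundary rays coincide. -/

theorem resolvent_sub_resolvent_apply (hz : z ∈ T.resolventSet) (hw : w ∈ T.resolventSet) (y : H) :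
    T.resolvent z y - T.resolvent w y = (w - z) • T.resolvent z (T.resolvent w y) := by
  obtain ⟨hd, e⟩ := (isResolventAt_resolvent hw).2 y
  have h1 := (isResolventAt_resolvent hz).1 ⟨T.resolvent w y, hd⟩
  have h2 : z • T.resolvent w y - T ⟨T.resolvent w y, hd⟩ = y + (z - w) • T.resolvent w y := by
    rw [sub_smul, sub_eq_iff_eq_add.1 e]
    abel
  simp only [h2, _root_.map_add, _root_.map_smul] at h1
  rw [← neg_sub z w, neg_smul, ← sub_eq_zero, ← sub_eq_zero.2 h1]
  abel

theorem resolvent_sub_resolvent (hz : z ∈ T.resolventSet) (hw : w ∈ T.resolventSet) :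
    T.resolvent z - T.resolvent w = (w - z) • (T.resolvent z ∘L T.resolvent w) := by
  ext y
  simpa using resolvent_sub_resolvent_apply hz hw y

theorem resolvent_comm (hz : z ∈ T.resolventSet) (hw : w ∈ T.resolventSet) (y : H) :
    T.resolvent z (T.resolvent w y) = T.resolvent w (T.resolvent z y) := by
  rcases eq_or_ne z w with rfl | hne
  · rfl
  have h1 := resolvent_sub_resolvent_apply hz hw y
  have h2 := resolvent_sub_resolvent_apply hw hz y
  have h3 : (w - z) • T.resolvent z (T.resolvent w y) =
      (w - z) • T.resolvent w (T.resolvent z y) := by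
    rw [← h1, ← neg_sub (T.resolvent w y), h2, ← neg_smul, neg_sub]
  exact smul_right_injective H (sub_ne_zero.2 hne.symm) h3

/-- The resolvent identity first gives the local bound `‖R(z)‖ ≤ 2‖R(z₀)‖` by absorption; inserted
again, it gives a local Lipschitz estimate. -/
theorem continuousOn_resolvent : ContinuousOn T.resolvent T.resolventSet := by
  intro z₀ h₀
  set A := T.resolvent z₀ with hA
  have hkey : ∀ᶠ z in nhdsWithin z₀ T.resolventSet,
      ‖T.resolvent z - A‖ ≤ 2 * ‖A‖ * ‖A‖ * ‖z - z₀‖ := by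
    have hsmall : ∀ᶠ z in nhdsWithin z₀ T.resolventSet, ‖z - z₀‖ * ‖A‖ < 1 / 2 := by
      have : Filter.Tendsto (fun z : ℂ => ‖z - z₀‖ * ‖A‖) (nhds z₀) (nhds (‖z₀ - z₀‖ * ‖A‖)) :=
        Continuous.tendsto (by fun_prop) z₀
      refine (this.mono_left nhdsWithin_le_nhds).eventually_lt_const ?_
      simp
    filter_upwards [hsmall, self_mem_nhdsWithin] with z hz hzr
    have e := resolvent_sub_resolvent hzr h₀
    have hb : ‖T.resolvent z - A‖ ≤ ‖z - z₀‖ * (‖T.resolvent z‖ * ‖A‖) := by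
      rw [e, norm_smul, norm_sub_rev z₀ z]
      gcongr
      exact ContinuousLinearMap.opNorm_comp_le _ _
    have hR : ‖T.resolvent z‖ ≤ 2 * ‖A‖ := by
      have h1 : ‖T.resolvent z‖ ≤ ‖T.resolvent z - A‖ + ‖A‖ := by
        simpa using norm_add_le (T.resolvent z - A) A
      have h2 : ‖z - z₀‖ * (‖T.resolvent z‖ * ‖A‖) ≤ 1 / 2 * ‖T.resolvent z‖ := by
        nlinarith [norm_nonneg (T.resolvent z)]
      linarith
    calc _ ≤ ‖z - z₀‖ * (‖T.resolvent z‖ * ‖A‖) := hb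
      _ ≤ ‖z - z₀‖ * ((2 * ‖A‖) * ‖A‖) := by gcongr
      _ = _ := by ring
  rw [ContinuousWithinAt, tendsto_iff_norm_sub_tendsto_zero]
  refine squeeze_zero' (Filter.Eventually.of_forall fun _ => norm_nonneg _) hkey ?_
  have : Filter.Tendsto (fun z : ℂ => 2 * ‖A‖ * ‖A‖ * ‖z - z₀‖) (nhds z₀)
      (nhds (2 * ‖A‖ * ‖A‖ * ‖z₀ - z₀‖)) := Continuous.tendsto (by fun_prop) z₀
  simpa using this.mono_left nhdsWithin_le_nhds

/-- The eigenspace `ker (T - μ)`, as a subspace of `H`. -/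
def eigenspace (T : H →ₗ.[ℂ] H) (μ : ℂ) : Submodule ℂ H :=
  (LinearMap.ker (T.toFun - μ • T.domain.subtype)).map T.domain.subtype

theorem mem_eigenspace {x : H} :
    x ∈ T.eigenspace μ ↔ ∃ h : x ∈ T.domain, T ⟨x, h⟩ = μ • x := by
  constructor
  · rintro ⟨⟨x, h⟩, hx, rfl⟩
    exact ⟨h, sub_eq_zero.1 hx⟩
  · rintro ⟨h, e⟩
    exact ⟨⟨x, h⟩, sub_eq_zero.2 e, rfl⟩

theorem finrank_eigenspace : Module.finrank ℂ (T.eigenspace μ) = T.geomMult μ :=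
  Submodule.finrank_map_subtype_eq _ _

theorem sub_smul_resolvent_of_mem_eigenspace {x : H} (hx : x ∈ T.eigenspace μ)
    (hz : z ∈ T.resolventSet) : (z - μ) • T.resolvent z x = x := by
  obtain ⟨h, e⟩ := mem_eigenspace.1 hx
  have h1 := (isResolventAt_resolvent hz).1 ⟨x, h⟩
  rw [e] at h1
  simpa [← sub_smul] using h1

theorem resolvent_of_mem_eigenspace {x : H} (hx : x ∈ T.eigenspace μ)
    (hz : z ∈ T.resolventSet) : T.resolvent z x = (z - μ)⁻¹ • x := by
  have h := sub_smul_resolvent_of_mem_eigenspace hx hz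
  rcases eq_or_ne (z - μ) 0 with h0 | h0
  · rw [h0, zero_smul] at h
    simp [← h]
  · rw [eq_inv_smul_iff₀ h0, h]

/-- This replaces any lower bound on the distance to the spectrum on the boundary of the sector. -/
theorem norm_inv_sub_le (he : T.eigenspace μ ≠ ⊥) (hz : z ∈ T.resolventSet) :
    ‖(z - μ)⁻¹‖ ≤ ‖T.resolvent z‖ := by
  obtain ⟨x, hx, hx0⟩ := Submodule.exists_mem_ne_zero_of_ne_bot he
  have h := (T.resolvent z).le_opNorm x
  rw [resolvent_of_mem_eigenspace hx hz, norm_smul] at h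
  exact le_of_mul_le_mul_right h (norm_pos_iff.2 hx0)

theorem eigenspace_resolvent (hz : z ∈ T.resolventSet) (hne : z ≠ μ) :
    Module.End.eigenspace (T.resolvent z : Module.End ℂ H) (z - μ)⁻¹ = T.eigenspace μ := by
  ext x
  rw [Module.End.mem_eigenspace_iff]
  refine ⟨fun h => ?_, fun h => resolvent_of_mem_eigenspace h hz⟩
  have h' : T.resolvent z x = (z - μ)⁻¹ • x := h
  have h0 := sub_ne_zero.2 hne
  obtain ⟨hd, e⟩ := (isResolventAt_resolvent hz).2 x
  have hxe : x = (z - μ) • T.resolvent z x := by rw [h', smul_inv_smul₀ h0]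
  have hxd : x ∈ T.domain := by
    rw [hxe]; exact T.domain.smul_mem _ hd
  refine mem_eigenspace.2 ⟨hxd, ?_⟩
  have hx2 : (⟨x, hxd⟩ : T.domain) = (z - μ) • ⟨T.resolvent z x, hd⟩ := Subtype.ext hxe
  have e2 : T ⟨T.resolvent z x, hd⟩ = z • T.resolvent z x - x := by
    nth_rewrite 3 [← e]; abel
  rw [hx2, T.map_smul, e2, h', smul_sub, smul_comm z, smul_inv_smul₀ h0, sub_smul]
  abel

/-- With `A = (z - T)⁻¹` and `u = (z - μ)⁻¹ - A` one has `(μ - T) A = (z - μ) u`, so the inverse of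
`μ - T` is `(z - μ)⁻¹ A u⁻¹`. -/
theorem mem_resolventSet_of_mem_resolventSet (hz : z ∈ T.resolventSet) (hne : z ≠ μ)
    (h : (z - μ)⁻¹ ∈ _root_.resolventSet ℂ (T.resolvent z)) : μ ∈ T.resolventSet := by
  have h0 := sub_ne_zero.2 hne
  obtain ⟨hA1, hA2⟩ := isResolventAt_resolvent hz
  obtain ⟨u, hu⟩ : IsUnit (algebraMap ℂ (H →L[ℂ] H) (z - μ)⁻¹ - T.resolvent z) := h
  set A := T.resolvent z with hA
  have hu' : ∀ x : H, (u : H →L[ℂ] H) x = (z - μ)⁻¹ • x - A x := fun x => by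
    rw [hu]; simp [Algebra.algebraMap_eq_smul_one]
  have hl : ∀ x : H, ((u⁻¹ : (H →L[ℂ] H)ˣ) : H →L[ℂ] H) ((u : H →L[ℂ] H) x) = x := fun x => by
    rw [← mul_apply_eq_comp, Units.inv_mul]; rfl
  have hr : ∀ x : H, (u : H →L[ℂ] H) (((u⁻¹ : (H →L[ℂ] H)ˣ) : H →L[ℂ] H) x) = x := fun x => by
    rw [← mul_apply_eq_comp, Units.mul_inv]; rfl
  set B := ((u⁻¹ : (H →L[ℂ] H)ˣ) : H →L[ℂ] H) with hB
  have hcomm : ∀ x, A (B x) = B (A x) := fun x => by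
    have : (u : H →L[ℂ] H) (A (B x)) = A x := by
      rw [hu', ← _root_.map_smul, ← _root_.map_sub, ← hu', hr]
    rw [← this, hl]
  refine ⟨(z - μ)⁻¹ • (A ∘L B), ?_, ?_⟩
  · intro x
    have h1 := hA1 x
    have h2 : μ • (x : H) - T x = (z • (x : H) - T x) - (z - μ) • (x : H) := by
      rw [sub_smul]; abel
    have h3 : A (μ • (x : H) - T x) = (z - μ) • (u : H →L[ℂ] H) (x : H) := by
      rw [h2, _root_.map_sub, h1, hu', smul_sub, smul_inv_smul₀ h0, _root_.map_smul]
    simp only [_root_.smul_apply, ContinuousLinearMap.comp_apply]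
    rw [hcomm, h3, _root_.map_smul, hl, inv_smul_smul₀ h0]
  · intro y
    obtain ⟨hd, e⟩ := hA2 (B y)
    refine ⟨T.domain.smul_mem _ hd, ?_⟩
    have hs : (⟨((z - μ)⁻¹ • (A ∘L B)) y, T.domain.smul_mem _ hd⟩ : T.domain) =
        (z - μ)⁻¹ • ⟨A (B y), hd⟩ := rfl
    have hy := hr y
    rw [hu'] at hy
    have e2 : T ⟨A (B y), hd⟩ = z • A (B y) - B y := by
      nth_rewrite 3 [← e]; abel
    rw [hs, T.map_smul, e2]
    simp only [_root_.smul_apply, ContinuousLinearMap.comp_apply]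
    rw [← hy]
    have : μ • (z - μ)⁻¹ • A (B y) - (z - μ)⁻¹ • (z • A (B y) - B y)
      = (z - μ)⁻¹ • B y - (z - μ)⁻¹ • ((z - μ) • A (B y)) := by
      rw [smul_comm μ, ← smul_sub, ← smul_sub, sub_smul]
      congr 1; abel
    rw [hy, this, inv_smul_smul₀ h0, hy]

/-- Fredholm alternative for the compact operator `(z - T)⁻¹` at the nonzero value `(z - μ)⁻¹`. -/
theorem eigenspace_ne_bot [CompleteSpace H] (hT : T.HasCompactResolvent) (hμ : μ ∈ T.spectrum) :
    T.eigenspace μ ≠ ⊥ := by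
  obtain ⟨z, hz, hc⟩ := hT
  have hne : z ≠ μ := by rintro rfl; exact hμ hz
  rcases hc.hasEigenvalue_or_mem_resolventSet (inv_ne_zero (sub_ne_zero.2 hne)) with h | h
  · rw [← eigenspace_resolvent hz hne]
    exact h
  · exact absurd (mem_resolventSet_of_mem_resolventSet hz hne h) hμ

/-- On this closed subspace the compact operator `(z - μ)(z - T)⁻¹` is the identity. -/
theorem finiteDimensional_eigenspace (hT : T.HasCompactResolvent) (hμ : μ ∈ T.spectrum) :
    FiniteDimensional ℂ (T.eigenspace μ) := by
  obtain ⟨z, hz, hc⟩ := hT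
  have hne : z ≠ μ := by rintro rfl; exact hμ hz
  have h0 := sub_ne_zero.2 hne
  have hclosed : _root_.IsClosed (T.eigenspace μ : Set H) := by
    rw [← eigenspace_resolvent hz hne]
    have : ((Module.End.eigenspace (T.resolvent z : Module.End ℂ H) (z - μ)⁻¹ : Submodule ℂ H) :
        Set H) = {x | T.resolvent z x = (z - μ)⁻¹ • x} := by
      ext x; exact Module.End.mem_eigenspace_iff
    rw [this]
    exact isClosed_eq (by fun_prop) (by fun_prop)
  apply FiniteDimensional.of_isCompactOperator_id (𝕜 := ℂ)
  have hmaps : ∀ v ∈ T.eigenspace μ, (((z - μ) • T.resolvent z : H →L[ℂ] H) : H →ₗ[ℂ] H) v ∈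
      T.eigenspace μ := fun v hv => by
    have := sub_smul_resolvent_of_mem_eigenspace hv hz
    simpa [this] using hv
  have hr := (hc.smul (z - μ)).restrict (f := (((z - μ) • T.resolvent z : H →L[ℂ] H) : H →ₗ[ℂ] H))
    hmaps hclosed
  convert hr using 1
  · rfl
  · funext v
    exact Subtype.ext (sub_smul_resolvent_of_mem_eigenspace v.2 hz).symm

/-! ### Riesz projections -/

theorem rieszRadius_nonneg : 0 ≤ T.rieszRadius μ := div_nonneg Metric.infDist_nonneg zero_le_two

theorem two_mul_rieszRadius_le (hν : ν ∈ T.spectrum) (hne : ν ≠ μ) :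
    2 * T.rieszRadius μ ≤ ‖ν - μ‖ := by
  have := Metric.infDist_le_dist_of_mem (x := μ) (s := T.spectrum \ {μ}) ⟨hν, hne⟩
  rw [dist_comm, dist_eq_norm] at this
  simpa [rieszRadius] using by linarith

theorem sphere_rieszRadius_subset (h : 0 < T.rieszRadius μ) :
    Metric.sphere μ (T.rieszRadius μ) ⊆ T.resolventSet := by
  intro z hz
  by_contra hz'
  have hne : z ≠ μ := by
    rintro rfl
    simp at hz
    exact h.ne' hz.symm
  have := two_mul_rieszRadius_le (T := T) (μ := μ) hz' hne
  rw [mem_sphere_iff_norm] at hz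
  linarith

theorem circleIntegrable_resolvent (h : 0 < T.rieszRadius μ) :
    CircleIntegrable T.resolvent μ (T.rieszRadius μ) :=
  (continuousOn_resolvent.mono (sphere_rieszRadius_subset h)).circleIntegrable h.le

/-- A circle of radius zero has zero integral. Isolation of the relevant spectral points is thus
read off from `Q_μ ≠ 0`, without a separate proof that the spectrum is discrete. -/
theorem rieszRadius_pos_of_rieszProj_ne_zero (h : T.rieszProj μ ≠ 0) : 0 < T.rieszRadius μ := by
  refine rieszRadius_nonneg.lt_of_ne fun h0 => h ?_
  rw [rieszProj, ← h0, circleIntegral.integral_radius_zero, smul_zero]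

theorem _root_.ContinuousLinearMap.circleIntegral_comp_comm {E F : Type*} [NormedAddCommGroup E]
    [NormedSpace ℂ E] [NormedAddCommGroup F] [NormedSpace ℂ F] [CompleteSpace E] [CompleteSpace F]
    (L : E →L[ℂ] F) {f : ℂ → E} {c : ℂ} {r : ℝ} (hf : CircleIntegrable f c r) :
    ∮ z in C(c, r), L (f z) = L (∮ z in C(c, r), f z) := by
  rw [circleIntegral, circleIntegral, ← L.intervalIntegral_comp_comm hf.out]
  simp

variable [CompleteSpace H]

theorem rieszProj_apply (h : 0 < T.rieszRadius μ) (x : H) :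
    T.rieszProj μ x =
      (2 * (Real.pi : ℂ) * Complex.I)⁻¹ • ∮ z in C(μ, T.rieszRadius μ), T.resolvent z x := by
  have := (ContinuousLinearMap.apply ℂ H x).circleIntegral_comp_comm (circleIntegrable_resolvent h)
  simp only [ContinuousLinearMap.apply_apply] at this
  rw [this, rieszProj, _root_.smul_apply]

theorem rieszProj_comm_of_commute {B : H →L[ℂ] H}
    (hB : ∀ z ∈ T.resolventSet, ∀ x, T.resolvent z (B x) = B (T.resolvent z x)) (x : H) :
    T.rieszProj μ (B x) = B (T.rieszProj μ x) := by
  by_cases h : 0 < T.rieszRadius μ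
  · have hi : CircleIntegrable (fun z => T.resolvent z x) μ (T.rieszRadius μ) :=
      ((continuousOn_resolvent.mono (sphere_rieszRadius_subset h)).clm_apply
        continuousOn_const).circleIntegrable h.le
    rw [rieszProj_apply h, rieszProj_apply h, _root_.map_smul, ← B.circleIntegral_comp_comm hi,
      circleIntegral.integral_congr h.le fun z hz => hB z (sphere_rieszRadius_subset h hz) x]
  · have : T.rieszProj μ = 0 := by
      by_contra h0
      exact h (rieszRadius_pos_of_rieszProj_ne_zero h0)
    simp [this]

theorem resolvent_rieszProj_comm (hz : z ∈ T.resolventSet) (x : H) :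
    T.rieszProj μ (T.resolvent z x) = T.resolvent z (T.rieszProj μ x) :=
  rieszProj_comm_of_commute (fun _ hw y => resolvent_comm hw hz y) x

theorem rieszProj_comm (x : H) :
    T.rieszProj μ (T.rieszProj ν x) = T.rieszProj ν (T.rieszProj μ x) :=
  rieszProj_comm_of_commute (fun _ hw y => (resolvent_rieszProj_comm hw y).symm) x

theorem rieszProj_of_mem_eigenspace (h : 0 < T.rieszRadius μ) {x : H} (hx : x ∈ T.eigenspace μ) :
    T.rieszProj μ x = x := by
  rw [rieszProj_apply h, circleIntegral.integral_congr h.le fun z hz =>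
    resolvent_of_mem_eigenspace hx (sphere_rieszRadius_subset h hz),
    circleIntegral.integral_smul_const, circleIntegral.integral_sub_center_inv _ h.ne', smul_smul,
    inv_mul_cancel₀ Complex.two_pi_I_ne_zero, one_smul]

theorem integral_sub_inv_of_notMem_closedBall {c w : ℂ} {r : ℝ} (hr : 0 ≤ r) (hw : r < ‖w - c‖) :
    ∮ z in C(c, r), (z - w)⁻¹ = 0 := by
  have hne : ∀ z ∈ Metric.closedBall c r, z - w ≠ 0 := fun z hz h0 => by
    rw [sub_eq_zero.1 h0, mem_closedBall_iff_norm] at hz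
    linarith
  refine DiffContOnCl.circleIntegral_eq_zero hr ?_
  refine DifferentiableOn.diffContOnCl fun z hz => ?_
  have := hne z (Metric.closure_ball_subset_closedBall hz)
  fun_prop (disch := assumption)

theorem rieszProj_of_mem_eigenspace_of_ne (hμ : μ ∈ T.spectrum) (hne : μ ≠ ν) {x : H}
    (hx : x ∈ T.eigenspace μ) : T.rieszProj ν x = 0 := by
  by_cases h : 0 < T.rieszRadius ν
  · have := two_mul_rieszRadius_le hμ hne
    rw [rieszProj_apply h, circleIntegral.integral_congr h.le fun z hz =>
      resolvent_of_mem_eigenspace hx (sphere_rieszRadius_subset h hz),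
      circleIntegral.integral_smul_const, integral_sub_inv_of_notMem_closedBall h.le (by linarith),
      zero_smul, smul_zero]
  · have : T.rieszProj ν = 0 := by
      by_contra h0
      exact h (rieszRadius_pos_of_rieszProj_ne_zero h0)
    simp [this]

/-- For a semisimple point `μ` of the spectrum, the range of the Riesz projection is the
eigenspace. -/
theorem range_rieszProj_of_geomMult_eq (hT : T.HasCompactResolvent) (hμ : μ ∈ T.spectrum)
    (h : T.geomMult μ = T.algMult μ) :
    LinearMap.range (T.rieszProj μ : H →ₗ[ℂ] H) = T.eigenspace μ ∧ 0 < T.rieszRadius μ ∧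
      0 < T.algMult μ := by
  have := finiteDimensional_eigenspace hT hμ
  have hpos : 0 < T.algMult μ := by
    rw [← h, ← finrank_eigenspace]
    have : Nontrivial (T.eigenspace μ) :=
      Submodule.nontrivial_iff_ne_bot.2 (eigenspace_ne_bot hT hμ)
    exact Module.finrank_pos
  have hQ : T.rieszProj μ ≠ 0 := fun h0 => by
    have : LinearMap.range (T.rieszProj μ : H →ₗ[ℂ] H) = ⊥ := by
      rw [LinearMap.range_eq_bot, h0]
      rfl
    rw [algMult, this, finrank_bot] at hpos
    exact hpos.false
  have hrad := rieszRadius_pos_of_rieszProj_ne_zero hQ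
  have : FiniteDimensional ℂ (LinearMap.range (T.rieszProj μ : H →ₗ[ℂ] H)) :=
    Module.finite_of_finrank_pos hpos
  -- `Q_μ` fixes the eigenspace, so the range contains it; equal finite dimensions give equality.
  refine ⟨(Submodule.eq_of_le_of_finrank_eq (fun x hx =>
    LinearMap.mem_range.2 ⟨x, rieszProj_of_mem_eigenspace hrad hx⟩)
    ?_).symm, hrad, hpos⟩
  rw [finrank_eigenspace, h, algMult]

/-- Outside the disc of integration, `(z - T)⁻¹ Q_μ` is a Cauchy integral. -/
theorem resolvent_rieszProj (h : 0 < T.rieszRadius μ) (hz : z ∈ T.resolventSet)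
    (hzμ : T.rieszRadius μ < ‖z - μ‖) (x : H) :
    T.resolvent z (T.rieszProj μ x) = (2 * (Real.pi : ℂ) * Complex.I)⁻¹ •
      ∮ ζ in C(μ, T.rieszRadius μ), (z - ζ)⁻¹ • T.resolvent ζ x := by
  have hcont : ContinuousOn (fun ζ => T.resolvent ζ x) (Metric.sphere μ (T.rieszRadius μ)) :=
    (continuousOn_resolvent.mono (sphere_rieszRadius_subset h)).clm_apply continuousOn_const
  have hne : ∀ ζ ∈ Metric.sphere μ (T.rieszRadius μ), z - ζ ≠ 0 := fun ζ hζ h0 => by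
    rw [← sub_eq_zero.1 h0, mem_sphere_iff_norm] at hζ
    linarith
  have hinv : ContinuousOn (fun ζ => (z - ζ)⁻¹) (Metric.sphere μ (T.rieszRadius μ)) :=
    (continuousOn_const.sub continuousOn_id).inv₀ hne
  have hpt : ∀ ζ ∈ Metric.sphere μ (T.rieszRadius μ),
      T.resolvent z (T.resolvent ζ x) =
        (z - ζ)⁻¹ • T.resolvent ζ x - (z - ζ)⁻¹ • T.resolvent z x := fun ζ hζ => by
    have := resolvent_sub_resolvent_apply (sphere_rieszRadius_subset h hζ) hz x
    rw [← smul_sub, this, resolvent_comm (sphere_rieszRadius_subset h hζ) hz,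
      inv_smul_smul₀ (hne ζ hζ)]
  have hzero : ∮ ζ in C(μ, T.rieszRadius μ), (z - ζ)⁻¹ • T.resolvent z x = 0 := by
    have e : ∀ ζ : ℂ, (z - ζ)⁻¹ = (-1 : ℂ) * (ζ - z)⁻¹ := fun ζ => by
      rw [← neg_sub ζ z, inv_neg]; ring
    rw [circleIntegral.integral_smul_const]
    simp only [e]
    rw [circleIntegral.integral_const_mul, integral_sub_inv_of_notMem_closedBall h.le hzμ]
    simp
  have h1 : CircleIntegrable (fun ζ => (z - ζ)⁻¹ • T.resolvent ζ x) μ (T.rieszRadius μ) :=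
    (hinv.smul hcont).circleIntegrable h.le
  have h2 : CircleIntegrable (fun ζ => (z - ζ)⁻¹ • T.resolvent z x) μ (T.rieszRadius μ) :=
    (hinv.smul continuousOn_const).circleIntegrable h.le
  rw [rieszProj_apply h, _root_.map_smul,
    ← (T.resolvent z).circleIntegral_comp_comm (hcont.circleIntegrable h.le),
    circleIntegral.integral_congr h.le hpt, circleIntegral.integral_sub h1 h2, hzero, sub_zero]

end LinearPMap

end ResolventTheory

/-! ### Cauchy transforms, the maximum principle on half-strips, and exceptional radii. -/

section ComplexAnalysis

open Complex Set Metric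

variable {F : Type*} [NormedAddCommGroup F] [NormedSpace ℂ F]

/-- The Cauchy transform of a continuous function on a circle is holomorphic outside the disc. -/
theorem differentiableAt_circleIntegral_sub_inv_smul [CompleteSpace F] {f : ℂ → F} {c z₀ : ℂ}
    {r : ℝ} (hr : 0 ≤ r) (hf : ContinuousOn f (sphere c r)) (hz : r < ‖z₀ - c‖) :
    DifferentiableAt ℂ (fun z => ∮ ζ in C(c, r), (z - ζ)⁻¹ • f ζ) z₀ := by
  set ε := (‖z₀ - c‖ - r) / 2 with hε
  have hε0 : 0 < ε := by rw [hε]; linarith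
  have hfar : ∀ z ∈ ball z₀ ε, ∀ θ : ℝ, ε ≤ ‖z - circleMap c r θ‖ := fun z hz' θ => by
    have h1 : ‖circleMap c r θ - c‖ = r := mem_sphere_iff_norm.1 (circleMap_mem_sphere c hr θ)
    have h2 : ‖z - z₀‖ < ε := mem_ball_iff_norm.1 hz'
    have h3 : ‖z₀ - c‖ ≤ ‖z - circleMap c r θ‖ + ‖circleMap c r θ - c‖ + ‖z - z₀‖ := by
      have e : z₀ - c = (z - circleMap c r θ) + (circleMap c r θ - c) - (z - z₀) := by ring
      rw [e]
      exact (norm_sub_le _ _).trans (by gcongr; exact norm_add_le _ _)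
    linarith
  have hne : ∀ z ∈ ball z₀ ε, ∀ θ : ℝ, z - circleMap c r θ ≠ 0 := fun z hz' θ =>
    norm_pos_iff.1 (hε0.trans_le (hfar z hz' θ))
  have hfc : Continuous fun θ : ℝ => f (circleMap c r θ) :=
    hf.comp_continuous (continuous_circleMap c r) fun θ => circleMap_mem_sphere c hr θ
  have hdc : Continuous fun θ : ℝ => deriv (circleMap c r) θ := by
    simp only [deriv_circleMap]
    fun_prop
  obtain ⟨M, hM⟩ := (isCompact_sphere c r).exists_bound_of_continuousOn hf
  have hcont : ∀ z ∈ ball z₀ ε, Continuous fun θ : ℝ =>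
      deriv (circleMap c r) θ • (z - circleMap c r θ)⁻¹ • f (circleMap c r θ) := fun z hz' =>
    hdc.smul (((continuous_const.sub (continuous_circleMap c r)).inv₀ (hne z hz')).smul hfc)
  have hz₀ : z₀ ∈ ball z₀ ε := mem_ball_self hε0
  have key := intervalIntegral.hasDerivAt_integral_of_dominated_loc_of_deriv_le
    (μ := MeasureTheory.volume) (a := 0) (b := 2 * Real.pi)
    (F := fun z θ => deriv (circleMap c r) θ • (z - circleMap c r θ)⁻¹ • f (circleMap c r θ))
    (F' := fun z θ => deriv (circleMap c r) θ •
      (-1 / (z - circleMap c r θ) ^ 2) • f (circleMap c r θ))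
    (bound := fun _ => r * ((1 / ε ^ 2) * M)) (ball_mem_nhds z₀ hε0)
    (Filter.eventually_of_mem (ball_mem_nhds z₀ hε0)
      fun z hz' => (hcont z hz').aestronglyMeasurable)
    ((hcont z₀ hz₀).intervalIntegrable _ _)
    (Continuous.aestronglyMeasurable (hdc.smul ((continuous_const.div
      ((continuous_const.sub (continuous_circleMap c r)).pow 2)
      fun θ => pow_ne_zero 2 (hne z₀ hz₀ θ)).smul hfc)))
    (Filter.Eventually.of_forall fun θ _ z hz' => ?_) intervalIntegrable_const
    (Filter.Eventually.of_forall fun θ _ z hz' => ?_)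
  · exact key.2.differentiableAt
  · rw [norm_smul, norm_smul, norm_div, norm_neg, norm_one, norm_pow]
    have h1 : ‖deriv (circleMap c r) θ‖ = r := by simp [abs_of_nonneg hr]
    rw [h1]
    gcongr
    · exact hfar z hz' θ
    · exact hM _ (circleMap_mem_sphere c hr θ)
  · have h1 : HasDerivAt (fun z => (z - circleMap c r θ)⁻¹) (-1 / (z - circleMap c r θ) ^ 2) z :=
      ((hasDerivAt_id z).sub_const _).inv (hne z hz' θ)
    exact (h1.smul_const _).const_smul _

/-- The maximum principle on a half-strip, for functions that tend to zero at infinity. -/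
theorem norm_le_of_halfStrip {g : ℂ → F} {a b D : ℝ} (hb : 0 < b)
    (hd : ∀ w : ℂ, a ≤ w.re → |w.im| ≤ b → DifferentiableAt ℂ g w)
    (hbd : ∀ w : ℂ, a ≤ w.re → |w.im| ≤ b → (w.re = a ∨ |w.im| = b) → ‖g w‖ ≤ D)
    (hlim : ∀ ε > 0, ∃ u : ℝ, ∀ w : ℂ, u ≤ w.re → |w.im| ≤ b → ‖g w‖ ≤ ε)
    {w : ℂ} (hw : a ≤ w.re) (hw' : |w.im| ≤ b) : ‖g w‖ ≤ D := by
  have hD : 0 ≤ D :=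
    (norm_nonneg _).trans (hbd (a : ℂ) (by simp) (by simpa using hb.le) (by simp))
  refine le_of_forall_pos_le_add fun ε hε => ?_
  obtain ⟨u₀, hu₀⟩ := hlim ε hε
  set u := max u₀ w.re + 1 with hu
  have h1 : u₀ ≤ u := (le_max_left _ _).trans (by linarith)
  have h2 : w.re < u := (le_max_right u₀ _).trans_lt (by linarith)
  have hau : a < u := hw.trans_lt h2
  have hcl : closure (Ioo a u ×ℂ Ioo (-b) b) = Icc a u ×ℂ Icc (-b) b := by
    rw [closure_reProdIm, closure_Ioo hau.ne, closure_Ioo (by linarith)]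
  refine norm_le_of_forall_mem_frontier_norm_le (U := Ioo a u ×ℂ Ioo (-b) b)
    ((isBounded_Ioo _ _).reProdIm (isBounded_Ioo _ _)) ?_ (fun z hz => ?_) ?_
  · refine DifferentiableOn.diffContOnCl fun z hz => ?_
    rw [hcl, mem_reProdIm] at hz
    exact (hd z hz.1.1 (abs_le.2 hz.2)).differentiableWithinAt
  · rw [frontier_reProdIm, closure_Ioo hau.ne, closure_Ioo (by linarith), frontier_Ioo hau,
      frontier_Ioo (by linarith)] at hz
    rcases hz with ⟨h3, h4⟩ | ⟨h3, h4⟩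
    · have h5 : |z.im| = b := by
        replace h4 : z.im = -b ∨ z.im = b := h4
        rcases h4 with h4 | h4 <;> simp [h4, abs_of_pos hb]
      exact (hbd z h3.1 h5.le (Or.inr h5)).trans (by linarith)
    · rcases h3 with h3 | h3
      · exact (hbd z h3.ge (abs_le.2 h4) (Or.inl h3)).trans (by linarith)
      · exact (hu₀ z (h1.trans h3.ge) (abs_le.2 h4)).trans (by linarith)
  · rw [hcl]
    exact ⟨⟨hw, h2.le⟩, abs_le.1 hw'⟩

/-- The quotient `(G w - G w₀) / (e ^ w - e ^ w₀)` has a removable singularity at `w₀`. -/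
theorem exists_differentiableAt_div_exp_sub {G : ℂ → ℂ} (hG : Differentiable ℂ G) (w₀ : ℂ) :
    ∃ φ : ℂ → ℂ, (∀ w : ℂ, |w.im - w₀.im| < 2 * Real.pi → DifferentiableAt ℂ φ w) ∧
      ∀ w, exp w ≠ exp w₀ → φ w = (G w - G w₀) / (exp w - exp w₀) := by
  have hds : ∀ g : ℂ → ℂ, Differentiable ℂ g → Differentiable ℂ (dslope g w₀) := fun g hg =>
    differentiableOn_univ.1 ((differentiableOn_dslope Filter.univ_mem).2 hg.differentiableOn)
  -- A quotient of entire difference quotients. The denominator vanishes only at `w₀ + 2πin` with `n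
  -- ≠ 0`, which the restriction on `w.im` excludes.
  refine ⟨fun w => dslope G w₀ w / dslope exp w₀ w, fun w hw => ?_, fun w hw => ?_⟩
  · refine (hds G hG w).div (hds exp differentiable_exp w) ?_
    rcases eq_or_ne w w₀ with rfl | hne
    · simp [dslope_same, exp_ne_zero]
    · rw [dslope_of_ne _ hne, slope_def_field]
      refine div_ne_zero (fun h => hne ?_) (sub_ne_zero.2 hne)
      obtain ⟨n, hn⟩ := exp_eq_exp_iff_exists_int.1 (sub_eq_zero.1 h)
      have him : w.im - w₀.im = n * (2 * Real.pi) := by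
        rw [hn]; simp
      rw [him, abs_mul, abs_of_pos Real.two_pi_pos] at hw
      have h1 : |(n : ℝ)| < 1 := by
        by_contra hcon
        have := mul_le_mul_of_nonneg_right (not_lt.1 hcon) Real.two_pi_pos.le
        linarith
      have h2 : n = 0 := by
        rw [← Int.cast_abs] at h1
        exact Int.abs_lt_one_iff.1 (by exact_mod_cast h1)
      rw [hn, h2]; simp
  · have hne : w ≠ w₀ := by rintro rfl; exact hw rfl
    simp only [dslope_of_ne _ hne, slope_def_field]
    exact div_div_div_cancel_right₀ (sub_ne_zero.2 hne) _ _

/-- A Phragmén–Lindelöf type estimate on a half-strip in the logarithmic coordinate, for a function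
with finitely many removable singularities. -/
theorem norm_add_sum_le_of_halfStrip {S : Finset ℂ} {v f : ℂ → F} {G : ℂ → ℂ} {a b D : ℝ} {m : ℕ}
    (hm : m ≠ 0) (hb : 0 < b) (hbπ : b ≤ Real.pi) (hG : Differentiable ℂ G)
    (hG1 : ∀ w : ℂ, |w.im| ≤ b → ‖G w‖ ≤ 1)
    (hf : ∀ z, Real.exp a ≤ ‖z‖ → DifferentiableAt ℂ f z)
    (hfb : ∃ C, ∀ z, Real.exp a ≤ ‖z‖ → ‖f z‖ ≤ C)
    (hS : ∀ μ ∈ S, μ ≠ 0 ∧ |μ.arg| < b)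
    (hbd : ∀ w : ℂ, a ≤ w.re → |w.im| ≤ b → (w.re = a ∨ |w.im| = b) → (∀ μ ∈ S, exp w ≠ μ) ∧
      ‖G w • f (exp w) + ∑ μ ∈ S, ((G w - G (log μ)) / (exp w - μ)) • v μ‖ ≤ D * ‖exp w‖ ^ m)
    {w : ℂ} (hw : a ≤ w.re) (hw' : |w.im| ≤ b) (hwS : ∀ μ ∈ S, exp w ≠ μ) :
    ‖G w • f (exp w) + ∑ μ ∈ S, ((G w - G (log μ)) / (exp w - μ)) • v μ‖ ≤ D * ‖exp w‖ ^ m := by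
  choose φ hφd hφ using fun μ => exists_differentiableAt_div_exp_sub hG (log μ)
  have hφe : ∀ w : ℂ, ∀ μ ∈ S, exp w ≠ μ → φ μ w = (G w - G (log μ)) / (exp w - μ) := by
    intro w μ hμ hne
    have := hφ μ w
    rw [exp_log (hS μ hμ).1] at this
    exact this hne
  set g : ℂ → F := fun w => exp (-(m * w)) • (G w • f (exp w) + ∑ μ ∈ S, φ μ w • v μ) with hg
  have hnorm : ∀ w : ℂ, ‖exp (-(m * w))‖ = (‖exp w‖ ^ m)⁻¹ := fun w => by
    rw [exp_neg, exp_nat_mul, norm_inv, norm_pow]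
  have hge : ∀ w : ℂ, (∀ μ ∈ S, exp w ≠ μ) → ‖g w‖ = (‖exp w‖ ^ m)⁻¹ *
      ‖G w • f (exp w) + ∑ μ ∈ S, ((G w - G (log μ)) / (exp w - μ)) • v μ‖ := fun w hw => by
    rw [hg, norm_smul, hnorm]
    congr 3
    exact Finset.sum_congr rfl fun μ hμ => by rw [hφe w μ hμ (hw μ hμ)]
  have hpos : ∀ w : ℂ, 0 < ‖exp w‖ ^ m := fun w => pow_pos (norm_pos_iff.2 (exp_ne_zero w)) m
  have hexp : ∀ w : ℂ, a ≤ w.re → Real.exp a ≤ ‖exp w‖ := fun w h => by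
    rw [norm_exp]; exact Real.exp_le_exp.2 h
  have hlim : ∀ ε > 0, ∃ u : ℝ, ∀ w : ℂ, u ≤ w.re → |w.im| ≤ b → ‖g w‖ ≤ ε := by
    intro ε hε
    obtain ⟨C, hC⟩ := hfb
    set M : ℝ := |C| + ∑ μ ∈ S, 2 * ‖v μ‖ with hM
    have hM0 : 0 ≤ M := by positivity
    -- Beyond `X` every pole is at distance at least one, and `M / X ≤ ε`.
    set X : ℝ := 1 + M / ε + ∑ μ ∈ S, (‖μ‖ + 1) with hX
    have hX1 : 1 ≤ X := by
      have : 0 ≤ ∑ μ ∈ S, (‖μ‖ + 1) := Finset.sum_nonneg fun _ _ => by positivity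
      have : 0 ≤ M / ε := by positivity
      linarith
    refine ⟨max a (Real.log X), fun w hw hw' => ?_⟩
    have hwa : a ≤ w.re := (le_max_left _ _).trans hw
    have hwX : X ≤ ‖exp w‖ := by
      rw [norm_exp, ← Real.exp_log (zero_lt_one.trans_le hX1)]
      exact Real.exp_le_exp.2 ((le_max_right _ _).trans hw)
    have hfar : ∀ μ ∈ S, 1 ≤ ‖exp w - μ‖ := fun μ hμ => by
      have h1 : ‖μ‖ + 1 ≤ ∑ μ ∈ S, (‖μ‖ + 1) :=
        Finset.single_le_sum (f := fun μ : ℂ => ‖μ‖ + 1) (fun _ _ => by positivity) hμ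
      have h2 : 0 ≤ M / ε := by positivity
      have h3 := norm_sub_norm_le (exp w) μ
      linarith
    have hne : ∀ μ ∈ S, exp w ≠ μ := fun μ hμ h => by
      have := hfar μ hμ
      rw [h, sub_self, norm_zero] at this
      linarith
    have hle : ‖G w • f (exp w) + ∑ μ ∈ S, ((G w - G (log μ)) / (exp w - μ)) • v μ‖ ≤ M := by
      refine (norm_add_le _ _).trans (add_le_add ?_ (norm_sum_le_of_le _ fun μ hμ => ?_))
      · rw [norm_smul]
        calc _ ≤ 1 * |C| := by
              gcongr
              · exact hG1 w hw'
              · exact (hC _ (hexp w hwa)).trans (le_abs_self C)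
          _ = _ := one_mul _
      · rw [norm_smul, norm_div]
        gcongr
        calc _ ≤ ‖G w - G (log μ)‖ := div_le_self (norm_nonneg _) (hfar μ hμ)
          _ ≤ ‖G w‖ + ‖G (log μ)‖ := norm_sub_le _ _
          _ ≤ 1 + 1 := add_le_add (hG1 w hw') (hG1 _ (by rw [log_im]; exact (hS μ hμ).2.le))
          _ = 2 := by norm_num
    rw [hge w hne, inv_mul_le_iff₀ (hpos w)]
    have hXm : X ≤ ‖exp w‖ ^ m := hwX.trans (le_self_pow₀ (hX1.trans hwX) hm)
    have hMX : M / ε ≤ X := by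
      have : 0 ≤ ∑ μ ∈ S, (‖μ‖ + 1) := Finset.sum_nonneg fun _ _ => by positivity
      linarith
    calc _ ≤ M := hle
      _ = M / ε * ε := (div_mul_cancel₀ _ hε.ne').symm
      _ ≤ ‖exp w‖ ^ m * ε := by gcongr; exact hMX.trans hXm
  have hgd : ∀ w : ℂ, a ≤ w.re → |w.im| ≤ b → DifferentiableAt ℂ g w := by
    intro w hw hw'
    have h1 : DifferentiableAt ℂ (fun w => f (exp w)) w :=
      (hf _ (hexp w hw)).comp w differentiable_exp.differentiableAt
    have h2 : ∀ μ ∈ S, DifferentiableAt ℂ (fun w => φ μ w • v μ) w := fun μ hμ => by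
      refine (hφd μ w ?_).smul_const _
      rw [log_im]
      have := abs_sub w.im μ.arg
      linarith [(hS μ hμ).2]
    have h3 : DifferentiableAt ℂ (fun w => ∑ μ ∈ S, φ μ w • v μ) w :=
      DifferentiableAt.fun_sum h2
    have h4 : DifferentiableAt ℂ (fun w : ℂ => exp (-(m * w))) w := by fun_prop
    exact h4.smul (((hG w).smul h1).add h3)
  have := norm_le_of_halfStrip hb hgd (D := D) (fun w h1 h2 h3 => ?_) hlim hw hw'
  · rwa [hge w hwS, inv_mul_le_iff₀ (hpos w), mul_comm] at this
  · obtain ⟨h4, h5⟩ := hbd w h1 h2 h3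
    rwa [hge w h4, inv_mul_le_iff₀ (hpos w), mul_comm]

/-- A countable union of intervals of finite total length does not cover a half-line. -/
theorem exists_forall_le_abs_sub {x d : ℕ → ℝ} (hd : Summable d) (hd0 : ∀ n, 0 ≤ d n) (X : ℝ) :
    ∃ ρ, X ≤ ρ ∧ ∀ n, d n ≤ |ρ - x n| := by
  by_contra! h
  have hsub : Ici X ⊆ ⋃ n, ball (x n) (d n) := fun ρ hρ => by
    obtain ⟨n, hn⟩ := h ρ hρ
    exact mem_iUnion.2 ⟨n, by rwa [mem_ball, Real.dist_eq]⟩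
  -- A cover would give the half-line finite Lebesgue measure, at most `2 ∑ d n`.
  have h1 := (MeasureTheory.measure_mono (μ := MeasureTheory.volume) hsub).trans
    (MeasureTheory.measure_iUnion_le _)
  simp only [Real.volume_Ici, Real.volume_ball] at h1
  rw [← ENNReal.ofReal_tsum_of_nonneg (fun n => by have := hd0 n; positivity) (hd.mul_left 2)] at h1
  exact ENNReal.ofReal_ne_top (top_le_iff.1 h1)

end ComplexAnalysis

/-! ### From bounds on the projections to a bound on the resolvent. -/

section ResolventBound

open Complex Set Metric

variable {H : Type*} [NormedAddCommGroup H] [InnerProductSpace ℂ H] [CompleteSpace H]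

namespace LinearPMap

variable {T : H →ₗ.[ℂ] H}

/-- If all spectral points in `L` are semisimple and all other discs of integration of Riesz
projections lie in the ball of radius `ρ`, then on the span of the ranges of the Riesz projections
the resolvent is, for `‖z‖ ≥ ρ`, a finite sum of simple poles plus a bounded holomorphic term. -/
theorem exists_resolvent_eq_add_sum (hT : T.HasCompactResolvent) {L : Set ℂ} {ρ : ℝ}
    (hL : ∀ μ ∈ L, μ ∈ T.spectrum ∧ T.geomMult μ = T.algMult μ)
    (hρ : ∀ μ ∈ T.spectrum, μ ∉ L → 0 < T.rieszRadius μ → ‖μ‖ + T.rieszRadius μ < ρ) {y : H}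
    (hy : y ∈ (⨆ μ ∈ T.spectrum, LinearMap.range (T.rieszProj μ : H →ₗ[ℂ] H) : Submodule ℂ H)) :
    ∃ (S : Finset ℂ) (f : ℂ → H), (∀ μ ∈ S, μ ∈ L) ∧ (∀ ν ∈ L, ν ∉ S → T.rieszProj ν y = 0) ∧
      (∀ z, ρ ≤ ‖z‖ → DifferentiableAt ℂ f z) ∧ (∃ C, ∀ z, ρ ≤ ‖z‖ → ‖f z‖ ≤ C) ∧
      ∀ z ∈ T.resolventSet, ρ ≤ ‖z‖ →
        T.resolvent z y = f z + ∑ μ ∈ S, (z - μ)⁻¹ • T.rieszProj μ y := by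
  classical
  rw [iSup_subtype'] at hy
  induction hy using Submodule.iSup_induction' with
  | mem μ y hy =>
    obtain ⟨μ, hμ⟩ := μ
    by_cases hμL : μ ∈ L
    · obtain ⟨hr, hpos, -⟩ := range_rieszProj_of_geomMult_eq hT hμ (hL μ hμL).2
      have hy' : y ∈ T.eigenspace μ := by rw [← hr]; exact hy
      refine ⟨{μ}, 0, by simpa using hμL, fun ν _ hνS => ?_, fun z _ => differentiableAt_const _,
        ⟨0, by simp⟩, fun z hz _ => ?_⟩
      · exact rieszProj_of_mem_eigenspace_of_ne hμ (fun h => hνS (by simp [h])) hy'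
      · simp [rieszProj_of_mem_eigenspace hpos hy', resolvent_of_mem_eigenspace hy' hz]
    · obtain ⟨x, rfl⟩ := LinearMap.mem_range.1 hy
      by_cases hpos : 0 < T.rieszRadius μ
      · have hlt := hρ μ hμ hμL hpos
        have hfar : ∀ z : ℂ, ρ ≤ ‖z‖ → ρ - ‖μ‖ ≤ ‖z - μ‖ := fun z hz => by
          have := norm_sub_norm_le z μ
          linarith
        have hcont : ContinuousOn (fun ζ => T.resolvent ζ x) (sphere μ (T.rieszRadius μ)) :=
          (continuousOn_resolvent.mono (sphere_rieszRadius_subset hpos)).clm_apply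
            continuousOn_const
        obtain ⟨M, hM⟩ := (isCompact_sphere μ (T.rieszRadius μ)).exists_bound_of_continuousOn hcont
        refine ⟨∅, fun z => (2 * (Real.pi : ℂ) * I)⁻¹ •
          ∮ ζ in C(μ, T.rieszRadius μ), (z - ζ)⁻¹ • T.resolvent ζ x, by simp, fun ν hν _ => ?_,
          fun z hz => ?_, ⟨T.rieszRadius μ * ((ρ - ‖μ‖ - T.rieszRadius μ)⁻¹ * M),
            fun z hz => ?_⟩, fun z hz hz' => ?_⟩
        · obtain ⟨hr, -, -⟩ := range_rieszProj_of_geomMult_eq hT (hL ν hν).1 (hL ν hν).2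
          have hne : ν ≠ μ := by rintro rfl; exact hμL hν
          have : T.rieszProj ν x ∈ T.eigenspace ν := by
            rw [← hr]; exact LinearMap.mem_range_self _ x
          exact (rieszProj_comm x).trans
            (rieszProj_of_mem_eigenspace_of_ne (hL ν hν).1 hne this)
        · exact (differentiableAt_circleIntegral_sub_inv_smul hpos.le hcont
            (by linarith [hfar z hz])).const_smul _
        · refine circleIntegral.norm_two_pi_i_inv_smul_integral_le_of_norm_le_const hpos.le
            fun ζ hζ => ?_
          rw [norm_smul, norm_inv]
          have h1 : ρ - ‖μ‖ - T.rieszRadius μ ≤ ‖z - ζ‖ := by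
            have h2 := norm_sub_norm_le (z - μ) (ζ - μ)
            rw [sub_sub_sub_cancel_right, mem_sphere_iff_norm.1 hζ] at h2
            linarith [hfar z hz]
          gcongr
          · exact inv_nonneg.2 (by linarith)
          · linarith
          · exact hM ζ hζ
        · rw [Finset.sum_empty, add_zero]
          exact resolvent_rieszProj hpos hz (by linarith [hfar z hz']) x
      · have h0 : (T.rieszProj μ : H →ₗ[ℂ] H) x = 0 := by
          have : T.rieszProj μ = 0 := by
            by_contra h0
            exact hpos (rieszRadius_pos_of_rieszProj_ne_zero h0)
          rw [this]; rfl
        rw [h0]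
        exact ⟨∅, 0, by simp, by simp, fun z _ => differentiableAt_const _, ⟨0, by simp⟩, by simp⟩
  | zero =>
    exact ⟨∅, 0, by simp, by simp, fun z _ => differentiableAt_const _, ⟨0, by simp⟩, by simp⟩
  | add y₁ y₂ _ _ h₁ h₂ =>
    obtain ⟨S₁, f₁, hS₁, hv₁, hd₁, ⟨C₁, hC₁⟩, hR₁⟩ := h₁
    obtain ⟨S₂, f₂, hS₂, hv₂, hd₂, ⟨C₂, hC₂⟩, hR₂⟩ := h₂
    refine ⟨S₁ ∪ S₂, f₁ + f₂, fun μ hμ => ?_, fun ν hν hνS => ?_,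
      fun z hz => (hd₁ z hz).add (hd₂ z hz), ⟨C₁ + C₂, fun z hz => ?_⟩, fun z hz hz' => ?_⟩
    · rcases Finset.mem_union.1 hμ with h | h
      exacts [hS₁ μ h, hS₂ μ h]
    · rw [Finset.mem_union, not_or] at hνS
      rw [_root_.map_add, hv₁ ν hν hνS.1, hv₂ ν hν hνS.2, add_zero]
    · exact norm_add_le_of_le (hC₁ z hz) (hC₂ z hz)
    · have e₁ : ∑ μ ∈ S₁, (z - μ)⁻¹ • T.rieszProj μ y₁ =
          ∑ μ ∈ S₁ ∪ S₂, (z - μ)⁻¹ • T.rieszProj μ y₁ :=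
        Finset.sum_subset Finset.subset_union_left fun μ hμ hμ' => by
          have hμS := (Finset.mem_union.1 hμ).resolve_left hμ'
          rw [hv₁ μ (hS₂ μ hμS) hμ', smul_zero]
      have e₂ : ∑ μ ∈ S₂, (z - μ)⁻¹ • T.rieszProj μ y₂ =
          ∑ μ ∈ S₁ ∪ S₂, (z - μ)⁻¹ • T.rieszProj μ y₂ :=
        Finset.sum_subset Finset.subset_union_right fun μ hμ hμ' => by
          have hμS := (Finset.mem_union.1 hμ).resolve_right hμ'
          rw [hv₂ μ (hS₁ μ hμS) hμ', smul_zero]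
      simp only [_root_.map_add, smul_add, Finset.sum_add_distrib]
      rw [hR₁ z hz hz', hR₂ z hz hz', e₁, e₂, Pi.add_apply]
      abel

/-- The resolvent in a sector is controlled by its values on the boundary of the sector and by the
weighted norms of the Riesz projections. -/
theorem norm_mul_norm_resolvent_le (hT : T.HasCompactResolvent)
    (hcomplete : Dense
      ((⨆ μ ∈ T.spectrum, LinearMap.range (T.rieszProj μ : H →ₗ[ℂ] H) : Submodule ℂ H) : Set H))
    {L : Set ℂ} {a b : ℝ} {G : ℂ → ℂ} {B A : ℝ} {m : ℕ}
    (hm : m ≠ 0) (hb : 0 < b) (hbπ : b ≤ Real.pi) (hG : Differentiable ℂ G)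
    (hG1 : ∀ w : ℂ, |w.im| ≤ b → ‖G w‖ ≤ 1)
    (hL : ∀ μ ∈ L, μ ∈ T.spectrum ∧ T.geomMult μ = T.algMult μ)
    (hρ : ∀ μ ∈ T.spectrum, μ ∉ L → 0 < T.rieszRadius μ → ‖μ‖ + T.rieszRadius μ < Real.exp a)
    (hLarg : ∀ μ ∈ L, μ ≠ 0 ∧ |μ.arg| < b)
    (hbd : ∀ w : ℂ, a ≤ w.re → |w.im| ≤ b → (w.re = a ∨ |w.im| = b) →
      exp w ∈ T.resolventSet ∧ ‖T.resolvent (exp w)‖ ≤ B * ‖exp w‖ ^ m)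
    (hA : ∀ S : Finset ℂ, (∀ μ ∈ S, μ ∈ L) → ∑ μ ∈ S, ‖G (log μ)‖ * ‖T.rieszProj μ‖ ≤ A)
    {w : ℂ} (hw : a ≤ w.re) (hw' : |w.im| ≤ b) (hwT : exp w ∈ T.resolventSet) {A' : ℝ}
    (hA' : ∀ S : Finset ℂ, (∀ μ ∈ S, μ ∈ L) →
      ∑ μ ∈ S, ‖G (log μ)‖ * ‖T.rieszProj μ‖ * ‖(exp w - μ)⁻¹‖ ≤ A') :
    ‖G w‖ * ‖T.resolvent (exp w)‖ ≤ B * (1 + A) * ‖exp w‖ ^ m + A' := by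
  set K := B * (1 + A) * ‖exp w‖ ^ m + A' with hK
  have hne : ∀ z ∈ T.resolventSet, ∀ μ ∈ L, z ≠ μ := by
    rintro z hz μ hμ rfl
    exact (hL z hμ).1 hz
  have hmain : ∀ y ∈ (⨆ μ ∈ T.spectrum, LinearMap.range (T.rieszProj μ : H →ₗ[ℂ] H) :
      Submodule ℂ H), ‖G w • T.resolvent (exp w) y‖ ≤ K * ‖y‖ := by
    intro y hy
    obtain ⟨S, f, hS, -, hfd, hfC, hf⟩ := exists_resolvent_eq_add_sum hT hL hρ hy
    have hexp : ∀ w : ℂ, a ≤ w.re → Real.exp a ≤ ‖exp w‖ := fun w h => by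
      rw [norm_exp]; exact Real.exp_le_exp.2 h
    -- The left side extends holomorphically across the poles; the right side is what can be
    -- estimated.
    have hid : ∀ w : ℂ, a ≤ w.re → exp w ∈ T.resolventSet →
        G w • f (exp w) + ∑ μ ∈ S, ((G w - G (log μ)) / (exp w - μ)) • T.rieszProj μ y =
        G w • T.resolvent (exp w) y -
          ∑ μ ∈ S, (G (log μ) * (exp w - μ)⁻¹) • T.rieszProj μ y := fun w h1 h2 => by
      rw [hf _ h2 (hexp w h1), smul_add, Finset.smul_sum, add_sub_assoc, ← Finset.sum_sub_distrib]
      congr 1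
      refine Finset.sum_congr rfl fun μ _ => ?_
      rw [smul_smul, ← sub_smul, ← sub_mul, div_eq_mul_inv]
    have hsum : ∀ z : ℂ, ‖∑ μ ∈ S, (G (log μ) * (z - μ)⁻¹) • T.rieszProj μ y‖ ≤
        (∑ μ ∈ S, ‖G (log μ)‖ * ‖T.rieszProj μ‖ * ‖(z - μ)⁻¹‖) * ‖y‖ := fun z => by
      rw [Finset.sum_mul]
      refine norm_sum_le_of_le _ fun μ _ => ?_
      rw [norm_smul, norm_mul]
      calc _ ≤ ‖G (log μ)‖ * ‖(z - μ)⁻¹‖ * (‖T.rieszProj μ‖ * ‖y‖) := by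
            gcongr; exact (T.rieszProj μ).le_opNorm y
        _ = _ := by ring
    have hstrip := norm_add_sum_le_of_halfStrip (S := S) (v := fun μ => T.rieszProj μ y) (f := f)
      (D := B * (1 + A) * ‖y‖) hm hb hbπ hG hG1 hfd hfC (fun μ hμ => hLarg μ (hS μ hμ))
      (fun w h1 h2 h3 => ?_) hw hw' (fun μ hμ => hne _ hwT μ (hS μ hμ))
    · rw [hid w hw hwT] at hstrip
      have h1 := norm_le_norm_add_norm_sub' (G w • T.resolvent (exp w) y)
        (∑ μ ∈ S, (G (log μ) * (exp w - μ)⁻¹) • T.rieszProj μ y)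
      have h2 := (hsum (exp w)).trans (mul_le_mul_of_nonneg_right (hA' S hS) (norm_nonneg y))
      rw [hK]
      linarith
    · obtain ⟨h4, h5⟩ := hbd w h1 h2 h3
      refine ⟨fun μ hμ => hne _ h4 μ (hS μ hμ), ?_⟩
      rw [hid w h1 h4]
      have h6 : ∑ μ ∈ S, ‖G (log μ)‖ * ‖T.rieszProj μ‖ * ‖(exp w - μ)⁻¹‖ ≤
          A * ‖T.resolvent (exp w)‖ :=
        calc _ ≤ ∑ μ ∈ S, ‖G (log μ)‖ * ‖T.rieszProj μ‖ * ‖T.resolvent (exp w)‖ := by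
              gcongr with μ hμ
              exact norm_inv_sub_le (eigenspace_ne_bot hT (hL μ (hS μ hμ)).1) h4
          _ = (∑ μ ∈ S, ‖G (log μ)‖ * ‖T.rieszProj μ‖) * ‖T.resolvent (exp w)‖ := by
              rw [Finset.sum_mul]
          _ ≤ _ := by gcongr; exact hA S hS
      have hA0 : 0 ≤ A := by simpa using hA ∅ (by simp)
      calc _ ≤ ‖G w • T.resolvent (exp w) y‖ +
            ‖∑ μ ∈ S, (G (log μ) * (exp w - μ)⁻¹) • T.rieszProj μ y‖ := norm_sub_le _ _
        _ ≤ 1 * (‖T.resolvent (exp w)‖ * ‖y‖) + A * ‖T.resolvent (exp w)‖ * ‖y‖ := by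
            rw [norm_smul]
            gcongr
            · exact hG1 w h2
            · exact (T.resolvent (exp w)).le_opNorm y
            · exact (hsum _).trans (by gcongr)
        _ = (1 + A) * ‖y‖ * ‖T.resolvent (exp w)‖ := by ring
        _ ≤ (1 + A) * ‖y‖ * (B * ‖exp w‖ ^ m) := by gcongr
        _ = _ := by ring
  have hall : ∀ y, ‖(G w • T.resolvent (exp w)) y‖ ≤ K * ‖y‖ := fun y => by
    refine hcomplete.induction (P := fun y => ‖(G w • T.resolvent (exp w)) y‖ ≤ K * ‖y‖)
      (fun y hy => hmain y hy) ?_ y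
    exact isClosed_le (by fun_prop) (by fun_prop)
  -- The operator norm bound needs `0 ≤ K`, which follows from `hall` only if there is a nonzero
  -- vector.
  rcases subsingleton_or_nontrivial H with hH | hH
  · have h0 : T.resolvent (exp w) = 0 := Subsingleton.elim _ _
    have hB0 : 0 ≤ B := by
      obtain ⟨-, h⟩ := hbd a (by simp) (by simpa using hb.le) (by simp)
      exact nonneg_of_mul_nonneg_left ((norm_nonneg _).trans h)
        (pow_pos (norm_pos_iff.2 (exp_ne_zero _)) m)
    have hA0 : 0 ≤ A := by simpa using hA ∅ (by simp)
    have hA0' : 0 ≤ A' := by simpa using hA' ∅ (by simp)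
    rw [h0, norm_zero, mul_zero, hK]
    positivity
  · have hK0 : 0 ≤ K := by
      obtain ⟨y, hy⟩ := exists_ne (0 : H)
      exact nonneg_of_mul_nonneg_left ((norm_nonneg _).trans (hall y)) (norm_pos_iff.2 hy)
    rw [← norm_smul]
    exact ContinuousLinearMap.opNorm_le_bound _ hK0 hall

end LinearPMap

end ResolventBound

/-! ### Comparison of exponentials and powers, and the size of the damping factor. -/

section Growth

open Filter Topology Asymptotics

theorem summable_exp_neg_mul_rpow {k s : ℝ} (hk : 0 < k) (hs : 0 < s) :
    Summable fun n : ℕ => Real.exp (-k * ((n : ℝ) + 1) ^ s) := by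
  have hlim : Tendsto (fun n : ℕ => ((n : ℝ) + 1) ^ s) atTop atTop :=
    (tendsto_rpow_atTop hs).comp
      (tendsto_atTop_add_const_right _ _ tendsto_natCast_atTop_atTop)
  have h := ((isLittleO_exp_neg_mul_rpow_atTop hk (-2 / s)).comp_tendsto hlim).isBigO
  refine summable_of_isBigO_nat ?_ h
  have h2 : Summable fun n : ℕ => (((n + 1 : ℕ) : ℝ)) ^ (-2 : ℝ) :=
    (summable_nat_add_iff 1).2 (Real.summable_nat_rpow.2 (by norm_num))
  refine h2.congr fun n => ?_
  have hn : (0 : ℝ) ≤ (n : ℝ) + 1 := by positivity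
  simp only [Function.comp_apply]
  rw [← Real.rpow_mul hn, mul_div_cancel₀ _ hs.ne']
  push_cast
  rfl

theorem eventually_mul_pow_add_lt_exp (B A : ℝ) (m : ℕ) {k s : ℝ} (hk : 0 < k) (hs : 0 < s) :
    ∀ᶠ x : ℝ in atTop, B * x ^ m + A < Real.exp (k * x ^ s) := by
  have hlim := tendsto_rpow_atTop hs
  have h1 := (isLittleO_rpow_exp_pos_mul_atTop (m / s) hk).comp_tendsto hlim
  have h2 := (isLittleO_rpow_exp_pos_mul_atTop 0 hk).comp_tendsto hlim
  have h3 := ((h1.const_mul_left B).add (h2.const_mul_left A)).bound (c := 1 / 2) (by norm_num)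
  filter_upwards [h3, eventually_ge_atTop 0] with x hx hx0
  simp only [Function.comp_apply, Real.rpow_zero, mul_one, Real.norm_eq_abs, Real.abs_exp] at hx
  rw [← Real.rpow_mul hx0, mul_div_cancel₀ _ hs.ne', Real.rpow_natCast] at hx
  have := Real.exp_pos (k * x ^ s)
  linarith [le_abs_self (B * x ^ m + A)]

theorem Complex.norm_exp_neg_mul_exp (t τ : ℝ) (w : ℂ) :
    ‖Complex.exp (-t * Complex.exp (τ * w))‖ =
      Real.exp (-(t * Real.exp (τ * w.re) * Real.cos (τ * w.im))) := by
  rw [Complex.norm_exp, neg_mul, Complex.neg_re, Complex.re_ofReal_mul, Complex.exp_re,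
    Complex.re_ofReal_mul, Complex.im_ofReal_mul]
  ring_nf

theorem Complex.norm_exp_neg_mul_exp_log (t τ : ℝ) {z : ℂ} (hz : z ≠ 0) :
    ‖Complex.exp (-t * Complex.exp (τ * Complex.log z))‖ =
      Real.exp (-(t * ‖z‖ ^ τ * Real.cos (τ * z.arg))) := by
  rw [Complex.norm_exp_neg_mul_exp, Complex.log_re, Complex.log_im,
    Real.rpow_def_of_pos (norm_pos_iff.2 hz), mul_comm τ (Real.log _)]

/-- Absolute values let the endpoint `w.im = -π` be included, where `arg` jumps to `π`. -/
theorem Complex.abs_arg_exp {w : ℂ} (hw : |w.im| ≤ Real.pi) : |(Complex.exp w).arg| = |w.im| := by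
  refine Real.injOn_cos ⟨abs_nonneg _, Complex.abs_arg_le_pi _⟩ ⟨abs_nonneg _, hw⟩ ?_
  rw [Real.cos_abs, Real.cos_abs, Complex.cos_arg (Complex.exp_ne_zero w), Complex.norm_exp,
    Complex.exp_re, mul_div_cancel_left₀ _ (Real.exp_pos _).ne']

end Growth

/-! ### The contradiction argument for sectorial operators. -/

section Sectorial

open Filter Topology

variable {H : Type*} [NormedAddCommGroup H] [InnerProductSpace ℂ H]

namespace LinearPMap.SectorialAssumption

variable {T : H →ₗ.[ℂ] H} {lam : ℕ → ℂ} {p : ℕ} {R ε₀ K N : ℝ}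

theorem pi_div_pos (hT : T.SectorialAssumption lam p R ε₀ K N) : 0 < Real.pi / p :=
  div_pos Real.pi_pos (Nat.cast_pos.2 hT.one_le_p)

theorem pi_div_le_pi (hT : T.SectorialAssumption lam p R ε₀ K N) : Real.pi / p ≤ Real.pi :=
  div_le_self Real.pi_pos.le (Nat.one_le_cast.2 hT.one_le_p)

theorem tendsto_norm (hT : T.SectorialAssumption lam p R ε₀ K N) :
    Tendsto (fun n => ‖lam n‖) atTop atTop := by
  obtain ⟨c, κ, hc, hκ, h⟩ := hT.eigenvalue_growth
  refine tendsto_atTop_mono h (Tendsto.const_mul_atTop hc ((tendsto_rpow_atTop hκ).comp ?_))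
  exact tendsto_atTop_add_const_right _ _ tendsto_natCast_atTop_atTop

theorem summable_exp (hT : T.SectorialAssumption lam p R ε₀ K N) {δ τ : ℝ} (hδ : 0 < δ)
    (hτ : 0 < τ) : Summable fun n => Real.exp (-δ * ‖lam n‖ ^ τ) := by
  obtain ⟨c, κ, hc, hκ, h⟩ := hT.eigenvalue_growth
  refine Summable.of_nonneg_of_le (fun n => (Real.exp_pos _).le) (fun n => ?_)
    (summable_exp_neg_mul_rpow (mul_pos hδ (Real.rpow_pos_of_pos hc τ)) (mul_pos hκ hτ))
  have hn : (0 : ℝ) ≤ (n : ℝ) + 1 := by positivity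
  rw [Real.exp_le_exp, Real.rpow_mul hn, neg_mul, neg_mul, neg_le_neg_iff, mul_assoc,
    ← Real.mul_rpow hc.le (Real.rpow_nonneg hn κ)]
  gcongr
  exact h n

/-- The rays bounding the sector lie in the resolvent set, and the resolvent grows polynomially
there. -/
theorem resolvent_exp_le (hT : T.SectorialAssumption lam p R ε₀ K N) {w : ℂ}
    (hw : R + 1 ≤ Real.exp w.re) (hw' : |w.im| = Real.pi / p) :
    Complex.exp w ∈ T.resolventSet ∧ ‖T.resolvent (Complex.exp w)‖ ≤ K * Real.exp w.re ^ N := by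
  have hp0 : (p : ℝ) ≠ 0 := Nat.cast_ne_zero.2 (by have := hT.one_le_p; omega)
  constructor
  · by_contra hmem
    rcases hT.spectrum_subset hmem with h | h
    · rw [mem_ball_zero_iff, Complex.norm_exp] at h
      linarith
    · have h1 : |(Complex.exp w).arg| ≤ (1 - ε₀) * (Real.pi / p) := h
      rw [Complex.abs_arg_exp (hw'.trans_le hT.pi_div_le_pi), hw'] at h1
      nlinarith [hT.pi_div_pos, hT.ε₀_mem.1]
  · have hexp : Complex.exp w = (Real.exp w.re : ℂ) * Complex.exp (Complex.I * (w.im : ℂ)) := by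
      rw [Complex.ofReal_exp, ← Complex.exp_add, mul_comm Complex.I, Complex.re_add_im]
    rcases (abs_eq hT.pi_div_pos.le).1 hw' with h | h
    · have := hT.resolvent_le _ hw 0 (by have := hT.one_le_p; omega)
      rw [hexp, h]
      simpa using this
    -- The last ray, at angle `2π - π/p`, is the lower boundary `-π/p` of the sector.
    · have h1 := hT.resolvent_le _ hw (p - 1) (by have := hT.one_le_p; omega)
      have h2 : Complex.I * ((Real.pi / p * (1 + 2 * ((p - 1 : ℕ) : ℝ)) : ℝ) : ℂ) =
          Complex.I * (w.im : ℂ) + 2 * Real.pi * Complex.I := by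
        have h3 : Real.pi / p * (1 + 2 * ((p - 1 : ℕ) : ℝ)) = w.im + 2 * Real.pi := by
          rw [h, Nat.cast_sub hT.one_le_p]
          field_simp
          push_cast
          ring
        rw [h3]
        push_cast
        ring
      rw [h2, Complex.exp_add, Complex.exp_two_pi_mul_I, mul_one, ← hexp] at h1
      exact h1

variable [CompleteSpace H]

/-- The Riesz projections grow at least as fast as the resolvent on a curve in the sector, up to
the factor `q` bounding `cos (τ arg λ)` from below. -/
theorem limsup_norm_rieszProj_eq_top (hT : T.SectorialAssumption lam p R ε₀ K N)
    {Γ : ℝ → ℂ} (hΓ_cont : ContinuousOn Γ (Set.Ioi 0))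
    (hΓ_mem : ∀ t : ℝ, 0 < t → |(Γ t).arg| ≤ Real.pi / p)
    (hΓ_lim : Tendsto (fun t => ‖Γ t‖) atTop atTop)
    {η r τ : ℝ} (hη : 0 < η) (hτ : 0 < τ) (hτp : τ ≤ (p : ℝ) / 2)
    (hres : ∀ z ∈ Γ '' Set.Ioi 0 ∩ T.resolventSet, r < ‖z‖ →
      Real.exp (η * ‖z‖ ^ τ) ≤ ‖T.resolvent z‖)
    {q γ : ℝ} (hq : ∀ᶠ n in atTop, |(lam n).arg| < Real.pi / p ∧ q ≤ Real.cos (τ * (lam n).arg))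
    (hγ : 0 < γ) (hγq : γ < η * q) :
    limsup (fun n : ℕ => ((‖T.rieszProj (lam n)‖ / Real.exp (γ * ‖lam n‖ ^ τ) : ℝ) : EReal))
      atTop = ⊤ := by
  by_contra hne
  obtain ⟨C, hC, -⟩ := EReal.lt_iff_exists_real_btwn.1 (lt_top_iff_ne_top.2 hne)
  obtain ⟨n₀, hn₀⟩ := eventually_atTop.1 (hq.and (eventually_lt_of_limsup_lt hC))
  have hQ : ∀ n, n₀ ≤ n → ‖T.rieszProj (lam n)‖ ≤ C * Real.exp (γ * ‖lam n‖ ^ τ) := fun n hn =>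
    ((div_lt_iff₀ (Real.exp_pos _)).1 (EReal.coe_lt_coe_iff.1 (hn₀ n hn).2)).le
  have hC0 : 0 ≤ C := nonneg_of_mul_nonneg_left
    ((norm_nonneg _).trans (hQ n₀ le_rfl)) (Real.exp_pos _)
  have hq0 : 0 < q := pos_of_mul_pos_right (hγ.trans hγq) hη.le
  obtain ⟨t, ht1, ht2⟩ := exists_between ((div_lt_iff₀ hq0).2 hγq)
  have ht0 : 0 < t := (div_pos hγ hq0).trans ht1
  rw [div_lt_iff₀ hq0] at ht1
  -- The surplus `tq - γ = 2δ` is split: one `δ` makes the sum over eigenvalues converge, the other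
  -- pays for the distance to the eigenvalues.
  set δ := (t * q - γ) / 2 with hδ
  have hδ0 : 0 < δ := by rw [hδ]; linarith
  -- the spectral points of large modulus
  obtain ⟨R₀, hR₀, hss⟩ := hT.semisimple
  -- Beyond `R₀` the eigenvalues are semisimple; beyond `‖lam n₀‖` they have index at least `n₀`, so
  -- `hQ` applies.
  set R₂ := max R₀ ‖lam n₀‖ with hR₂
  have hR₂0 : 0 < R₂ := hT.R_pos.trans (hR₀.trans_le (le_max_left _ _))
  set L : Set ℂ := {μ | μ ∈ T.spectrum ∧ R₂ < ‖μ‖} with hLdef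
  have hL : ∀ μ ∈ L, μ ∈ T.spectrum ∧ T.geomMult μ = T.algMult μ := fun μ hμ =>
    ⟨hμ.1, hss μ hμ.1 ((le_max_left _ _).trans_lt hμ.2)⟩
  have hLn : ∀ μ ∈ L, ∃ n, n₀ ≤ n ∧ lam n = μ := fun μ hμ => by
    have h1 := (range_rieszProj_of_geomMult_eq hT.hasCompactResolvent (hL μ hμ).1 (hL μ hμ).2).2.2
    have h2 := hT.isEigenvalueSequence.encard_eq μ hμ.1
    have h3 : {n | lam n = μ}.Nonempty := by
      rw [← Set.encard_ne_zero, h2]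
      exact_mod_cast h1.ne'
    obtain ⟨n, hn⟩ := h3
    refine ⟨n, ?_, hn⟩
    by_contra hlt
    have h4 := hT.isEigenvalueSequence.monotone_norm (not_le.1 hlt).le
    have h5 : ‖μ‖ ≤ ‖lam n₀‖ := by rw [← hn]; exact h4
    linarith [hμ.2, le_max_right R₀ ‖lam n₀‖]
  have hL0 : ∀ μ ∈ L, μ ≠ 0 := fun μ hμ => norm_pos_iff.1 (hR₂0.trans hμ.2)
  -- a common bound for the discs of integration of the other Riesz projections
  obtain ⟨n₁, hn₁⟩ := (hT.tendsto_norm.eventually_gt_atTop ‖lam 0‖).exists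
  have hsmall : ∀ μ ∈ T.spectrum, μ ∉ L → ‖μ‖ + T.rieszRadius μ < R₂ + R₂ + ‖lam n₁‖ := by
    intro μ hμ hμL
    have h1 : ‖μ‖ ≤ R₂ := not_lt.1 fun h => hμL ⟨hμ, h⟩
    have h2 : ∃ n, lam n ≠ μ ∧ ‖lam n‖ ≤ ‖lam n₁‖ := by
      by_cases h : lam n₁ = μ
      · refine ⟨0, fun h0 => ?_, hn₁.le⟩
        rw [h, h0] at hn₁
        exact hn₁.false
      · exact ⟨n₁, h, le_rfl⟩
    obtain ⟨n, h3, h4⟩ := h2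
    have h5 := two_mul_rieszRadius_le (hT.isEigenvalueSequence.mem_spectrum n) h3
    have h6 := norm_sub_le (lam n) μ
    have h7 := norm_nonneg (lam 0)
    linarith
  -- moduli far from the moduli of the eigenvalues
  have hsum := hT.summable_exp hδ0 hτ
  have hoff : ∀ X : ℝ, ∃ ρ, X ≤ ρ ∧ ∀ n, Real.exp (-δ * ‖lam n‖ ^ τ) ≤ |ρ - ‖lam n‖| :=
    exists_forall_le_abs_sub hsum fun n => (Real.exp_pos _).le
  have hoff_mem : ∀ ρ, R₂ < ρ → (∀ n, Real.exp (-δ * ‖lam n‖ ^ τ) ≤ |ρ - ‖lam n‖|) →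
      ∀ z : ℂ, ‖z‖ = ρ → z ∈ T.resolventSet := by
    intro ρ hρ hρn z hz
    by_contra hmem
    obtain ⟨n, -, hn⟩ := hLn z ⟨hmem, hz ▸ hρ⟩
    have := hρn n
    rw [hn, hz, sub_self, abs_zero] at this
    exact (Real.exp_pos _).not_ge this
  obtain ⟨R₁, hR₁, hR₁n⟩ := hoff (R₂ + R₂ + ‖lam n₁‖ + R + 1)
  have hR := hT.R_pos
  have hnn := norm_nonneg (lam n₁)
  have hR₁0 : 0 < R₁ := by linarith
  have ha : Real.exp (Real.log R₁) = R₁ := Real.exp_log hR₁0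
  have hsphere := hoff_mem R₁ (by linarith) hR₁n
  obtain ⟨C₁, hC₁⟩ := (isCompact_sphere (0 : ℂ) R₁).exists_bound_of_continuousOn
    (continuousOn_resolvent.mono fun z hz => hsphere z (mem_sphere_zero_iff_norm.1 hz))
  have hC₁0 : 0 ≤ C₁ := (norm_nonneg _).trans (hC₁ (R₁ : ℂ) (by simp [hR₁0.le]))
  set m : ℕ := ⌈N⌉₊ + 1 with hm
  have hNm : N ≤ m := (Nat.le_ceil N).trans (by rw [hm]; push_cast; linarith)
  set B := K + C₁ with hB
  have hK0 : 0 ≤ K := zero_le_one.trans hT.one_le_K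
  set b := Real.pi / p with hb
  have hp0 : (0 : ℝ) < p := Nat.cast_pos.2 hT.one_le_p
  set G : ℂ → ℂ := fun w => Complex.exp (-t * Complex.exp (τ * w)) with hG
  have hGd : Differentiable ℂ G := by rw [hG]; fun_prop
  have hG1 : ∀ w : ℂ, |w.im| ≤ b → ‖G w‖ ≤ 1 := fun w hw => by
    rw [hG, Complex.norm_exp_neg_mul_exp, Real.exp_le_one_iff, neg_nonpos]
    refine mul_nonneg (by positivity) (Real.cos_nonneg_of_mem_Icc (abs_le.1 ?_))
    rw [abs_mul, abs_of_pos hτ]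
    calc _ ≤ (p : ℝ) / 2 * (Real.pi / p) := by gcongr
      _ = _ := by field_simp
  have hGL : ∀ n, n₀ ≤ n → lam n ≠ 0 →
      ‖G (Complex.log (lam n))‖ * ‖T.rieszProj (lam n)‖ * Real.exp (δ * ‖lam n‖ ^ τ) ≤
        C * Real.exp (-δ * ‖lam n‖ ^ τ) := fun n hn hn0 => by
    rw [hG, Complex.norm_exp_neg_mul_exp_log t τ hn0]
    have hx : 0 ≤ ‖lam n‖ ^ τ := by positivity
    calc _ ≤ Real.exp (-(t * ‖lam n‖ ^ τ * q)) * (C * Real.exp (γ * ‖lam n‖ ^ τ)) *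
          Real.exp (δ * ‖lam n‖ ^ τ) := by
          gcongr
          · exact (hn₀ n hn).1.2
          · exact hQ n hn
      _ = C * Real.exp (-(t * ‖lam n‖ ^ τ * q) + γ * ‖lam n‖ ^ τ + δ * ‖lam n‖ ^ τ) := by
          rw [Real.exp_add, Real.exp_add]; ring
      _ = _ := by
          congr 2
          have : t * q = γ + 2 * δ := by rw [hδ]; ring
          linear_combination (-‖lam n‖ ^ τ) * this
  set A := ∑' n, C * Real.exp (-δ * ‖lam n‖ ^ τ) with hAdef
  -- Choosing one index per spectral point is injective, so sums over points are dominated by the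
  -- series over `n`.
  have hsumL : ∀ (S : Finset ℂ) (h : ℂ → ℝ), (∀ μ ∈ S, μ ∈ L) →
      (∀ n, n₀ ≤ n → lam n ∈ L → h (lam n) ≤ C * Real.exp (-δ * ‖lam n‖ ^ τ)) →
      ∑ μ ∈ S, h μ ≤ A := by
    intro S h hS hh
    choose! ι hι hι' using hLn
    have hinj : Set.InjOn ι S := fun μ hμ ν hν e => by
      rw [← hι' μ (hS μ hμ), e, hι' ν (hS ν hν)]
    calc ∑ μ ∈ S, h μ ≤ ∑ μ ∈ S, C * Real.exp (-δ * ‖lam (ι μ)‖ ^ τ) := by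
          refine Finset.sum_le_sum fun μ hμ => ?_
          have e := hι' μ (hS μ hμ)
          have := hh (ι μ) (hι μ (hS μ hμ)) (by rw [e]; exact hS μ hμ)
          rwa [e] at this ⊢
      _ = ∑ n ∈ S.image ι, C * Real.exp (-δ * ‖lam n‖ ^ τ) := by
          rw [Finset.sum_image hinj]
      _ ≤ A := (hsum.mul_left C).sum_le_tsum _ fun n _ => by positivity
  have hA : ∀ S : Finset ℂ, (∀ μ ∈ S, μ ∈ L) →
      ∑ μ ∈ S, ‖G (Complex.log μ)‖ * ‖T.rieszProj μ‖ ≤ A := fun S hS => by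
    refine hsumL S _ hS fun n hn hnL => (le_mul_of_one_le_right (by positivity) ?_).trans
      (hGL n hn (hL0 _ hnL))
    exact Real.one_le_exp (by positivity)
  have hbd : ∀ w : ℂ, Real.log R₁ ≤ w.re → |w.im| ≤ b → (w.re = Real.log R₁ ∨ |w.im| = b) →
      Complex.exp w ∈ T.resolventSet ∧
        ‖T.resolvent (Complex.exp w)‖ ≤ B * ‖Complex.exp w‖ ^ m := by
    intro w hw hw' hw''
    have hwR : R₁ ≤ Real.exp w.re := by rw [← ha]; exact Real.exp_le_exp.2 hw
    have hw1 : 1 ≤ Real.exp w.re := by linarith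
    rcases hw'' with h | h
    · have hz : ‖Complex.exp w‖ = R₁ := by rw [Complex.norm_exp, h, ha]
      refine ⟨hsphere _ hz, (hC₁ _ (mem_sphere_zero_iff_norm.2 hz)).trans ?_⟩
      rw [Complex.norm_exp]
      calc C₁ = C₁ * 1 := (mul_one _).symm
        _ ≤ B * Real.exp w.re ^ m := by
          gcongr
          · linarith
          · exact one_le_pow₀ hw1
    · obtain ⟨h1, h2⟩ := hT.resolvent_exp_le (w := w) (by linarith) h
      refine ⟨h1, h2.trans ?_⟩
      rw [Complex.norm_exp, ← Real.rpow_natCast]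
      gcongr
      linarith
  -- a point of the curve where the resolvent is too small
  obtain ⟨X, hX⟩ := eventually_atTop.1
    (eventually_mul_pow_add_lt_exp (B * (1 + A)) A m (sub_pos.2 ht2) hτ)
  -- Since `ρ ≥ ‖Γ 1‖`, the intermediate value theorem makes the curve cross the circle of radius
  -- `ρ`.
  obtain ⟨ρ, hρ, hρn⟩ := hoff (max (max X R₁) (max (r + 1) ‖Γ 1‖))
  simp only [max_le_iff] at hρ
  obtain ⟨⟨hρX, hρR⟩, hρr, hρΓ⟩ := hρ
  obtain ⟨s₁, hs₁, hs₁'⟩ := ((hΓ_lim.eventually_ge_atTop ρ).and (eventually_ge_atTop 1)).exists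
  obtain ⟨s, hs, hsρ⟩ := intermediate_value_Icc hs₁'
    ((hΓ_cont.norm).mono fun x hx => zero_lt_one.trans_le hx.1) ⟨hρΓ, hs₁⟩
  have hs0 : 0 < s := zero_lt_one.trans_le hs.1
  simp only at hsρ
  set z := Γ s with hz
  have hρ0 : 0 < ρ := hR₁0.trans_le hρR
  have hz0 : z ≠ 0 := norm_pos_iff.1 (hsρ ▸ hρ0)
  have hzT : z ∈ T.resolventSet := hoff_mem ρ (by linarith) hρn z hsρ
  have hlow := hres z ⟨⟨s, hs0, rfl⟩, hzT⟩ (by linarith)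
  have hez : Complex.exp (Complex.log z) = z := Complex.exp_log hz0
  have hup := norm_mul_norm_resolvent_le hT.hasCompactResolvent hT.complete (L := L)
    (a := Real.log R₁) (b := b) (G := G) (B := B) (A := A) (m := m) (Nat.succ_ne_zero _)
    hT.pi_div_pos hT.pi_div_le_pi hGd hG1 hL
    (fun μ hμ hμL _ => by rw [ha]; linarith [hsmall μ hμ hμL])
    (fun μ hμ => ⟨hL0 μ hμ, by
      obtain ⟨n, hn, rfl⟩ := hLn μ hμ
      exact (hn₀ n hn).1.1⟩) hbd hA (w := Complex.log z)
    (by rw [Complex.log_re, hsρ]; exact Real.log_le_log hR₁0 hρR)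
    (by rw [Complex.log_im]; exact hΓ_mem s hs0) (by rwa [hez]) (A' := A) (fun S hS => by
      -- On this circle `‖z - lam n‖ ≥ |ρ - ‖lam n‖| ≥ exp(-δ ‖lam n‖^τ)`, so the reserved factor in
      -- `hGL` absorbs `‖(z - lam n)⁻¹‖` and `A` serves again as `A'`.
      refine hsumL S _ hS fun n hn hnL => le_trans ?_ (hGL n hn (hL0 _ hnL))
      gcongr
      rw [hez, norm_inv]
      have h1 : Real.exp (-δ * ‖lam n‖ ^ τ) ≤ ‖z - lam n‖ := by
        refine (hρn n).trans ?_
        rw [← hsρ]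
        exact abs_norm_sub_norm_le z (lam n)
      calc _ ≤ (Real.exp (-δ * ‖lam n‖ ^ τ))⁻¹ := inv_anti₀ (Real.exp_pos _) h1
        _ = _ := by rw [← Real.exp_neg, neg_mul, neg_neg])
  rw [hez, hsρ] at hup
  have hGz : Real.exp (-(t * ρ ^ τ)) ≤ ‖G (Complex.log z)‖ := by
    rw [hG, Complex.norm_exp_neg_mul_exp_log t τ hz0, hsρ]
    refine Real.exp_le_exp.2 (neg_le_neg ?_)
    exact mul_le_of_le_one_right (by positivity) (Real.cos_le_one _)
  have hfin : Real.exp ((η - t) * ρ ^ τ) ≤ ‖G (Complex.log z)‖ * ‖T.resolvent z‖ := by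
    have e : (η - t) * ρ ^ τ = -(t * ρ ^ τ) + η * ρ ^ τ := by ring
    rw [e, Real.exp_add]
    rw [hsρ] at hlow
    gcongr
  linarith [hX ρ hρX]

end LinearPMap.SectorialAssumption

end Sectorial

/-! ### The two choices of the lower bound for `cos (τ arg λ_n)`. -/

theorem corollary4p5 {H : Type*} [NormedAddCommGroup H] [InnerProductSpace ℂ H] [CompleteSpace H]
    [TopologicalSpace.SeparableSpace H]
    (T : H →ₗ.[ℂ] H) (lam : ℕ → ℂ) (p : ℕ) (R ε₀ K N : ℝ)
    (hT : T.SectorialAssumption lam p R ε₀ K N)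
    (ε₁ : ℝ) (hε₁ : ε₁ ∈ Set.Ioc (0 : ℝ) 1)
    (Γ : ℝ → ℂ) (hΓ_cont : ContinuousOn Γ (Set.Ioi 0))
    (hΓ_mem : ∀ t : ℝ, 0 < t →
      1 ≤ (Γ t).re ∧ |(Γ t).arg| ≤ (1 - ε₁) * (Real.pi / p))
    (hΓ_lim : Filter.Tendsto (fun t => ‖Γ t‖) Filter.atTop Filter.atTop)
    (η r τ : ℝ) (hη : 0 < η) (hr : 0 < r) (hτ : 0 < τ) (hτp : τ ≤ (p : ℝ) / 2)
    (hres : ∀ z ∈ Γ '' Set.Ioi 0 ∩ T.resolventSet, r < ‖z‖ →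
      Real.exp (η * ‖z‖ ^ τ) ≤ ‖T.resolvent z‖)
    (hN : τ = (p : ℝ) / 2 → N < -1 + 1 / (2 * (p : ℝ))) :
    (∀ γ : ℝ, 0 < γ → γ < η * Real.cos ((1 - ε₀) * (τ / p) * Real.pi) →
      Filter.limsup
        (fun n : ℕ => ((‖T.rieszProj (lam n)‖ / Real.exp (γ * ‖lam n‖ ^ τ) : ℝ) : EReal))
        Filter.atTop = ⊤) ∧
    (∀ ϑ₀ : ℝ, ϑ₀ ∈ Set.Ioo (-(Real.pi / p)) (Real.pi / p) →
      Filter.Tendsto (fun n => (lam n).arg) Filter.atTop (nhds ϑ₀) →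
      ∀ γ : ℝ, 0 < γ → γ < η * Real.cos (τ * ϑ₀) →
        Filter.limsup
          (fun n : ℕ => ((‖T.rieszProj (lam n)‖ / Real.exp (γ * ‖lam n‖ ^ τ) : ℝ) : EReal))
          Filter.atTop = ⊤) := by
  have hlim := hT.tendsto_norm
  have hp0 : (0 : ℝ) < p := Nat.cast_pos.2 hT.one_le_p
  have hΓ_arg : ∀ t : ℝ, 0 < t → |(Γ t).arg| ≤ Real.pi / p := fun t ht =>
    (hΓ_mem t ht).2.trans (mul_le_of_le_one_left hT.pi_div_pos.le (by linarith [hε₁.1]))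
  refine ⟨fun γ hγ hγ' => hT.limsup_norm_rieszProj_eq_top hΓ_cont hΓ_arg hΓ_lim hη hτ hτp hres
    ?_ hγ hγ', fun ϑ₀ hϑ₀ harg γ hγ hγ' => ?_⟩
  · filter_upwards [hlim.eventually_ge_atTop R] with n hn
    have harg : |(lam n).arg| ≤ (1 - ε₀) * (Real.pi / p) := by
      rcases hT.spectrum_subset (hT.isEigenvalueSequence.mem_spectrum n) with h | h
      · exact absurd (mem_ball_zero_iff.1 h) hn.not_gt
      · exact h
    obtain ⟨hε1, hε2⟩ := hT.ε₀_mem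
    refine ⟨harg.trans_lt (mul_lt_of_lt_one_left hT.pi_div_pos (by linarith)), ?_⟩
    rw [← Real.cos_abs (τ * (lam n).arg), abs_mul, abs_of_pos hτ]
    -- Cosine decreases on `[0, π]`, so its worst value occurs at the edge of the spectral sector.
    refine Real.cos_le_cos_of_nonneg_of_le_pi (by positivity) ?_ ?_
    · have h1 : τ / p ≤ 1 / 2 := by rw [div_le_iff₀ hp0]; linarith
      have h2 : (1 - ε₀) * (τ / p) ≤ 1 * (1 / 2) := by
        gcongr
        linarith
      nlinarith [Real.pi_pos]
    · calc τ * |(lam n).arg| ≤ τ * ((1 - ε₀) * (Real.pi / p)) := by gcongr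
        _ = (1 - ε₀) * (τ / p) * Real.pi := by ring
  · rw [← div_lt_iff₀' hη] at hγ'
    -- Only the limit of the cosines is known, so `q` is taken strictly below it and still above
    -- `γ/η`.
    obtain ⟨q, hq1, hq2⟩ := exists_between hγ'
    refine hT.limsup_norm_rieszProj_eq_top hΓ_cont hΓ_arg hΓ_lim hη hτ hτp hres (q := q)
      ?_ hγ ((div_lt_iff₀' hη).1 hq1)
    have hcos : Filter.Tendsto (fun n => Real.cos (τ * (lam n).arg)) Filter.atTop
        (nhds (Real.cos (τ * ϑ₀))) :=
      (Real.continuous_cos.tendsto _).comp (harg.const_mul τ)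
    filter_upwards [harg.eventually (Ioo_mem_nhds hϑ₀.1 hϑ₀.2), hcos.eventually_const_le hq2]
      with n h1 h2
    exact ⟨abs_lt.2 h1, h2⟩
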